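/- **Setting.** Let $n\ge 2$, $\hbar,m_0,\tau>0$, $c_\hbar=\hbar^2/(2m_0)$, $X_k>0$, let $J_k\ge 1$ be integers and $h_k=X_k/J_k$ ($1\le k\le n$). Let $0<X_0<X_1$ with $2h_1\le X_1-X_0$. Let $V(x)$ and $\widetilde V(x_1)$ be real potentials with $V(x)=V_\infty$ for $x\in[X_0,\infty)\times(0,X_2)\times\dots\times(0,X_n)$ and $\widetilde V(x_1)=V_\infty$ for $x_1\ge X_0$; put $\Delta V=V-\widetilde V$. The infinite mesh $\overline\omega_{h,\infty}$ consists of the nodes $x_{\mathbf j}=(j_1h_1,\dots,j_nh_n)$ with $j_1\ge 0$, $0\le j_k\le J_k$ for $k\ge2$. Its internal part $\omega_{h,\infty}$ is given by $j_1\ge1$, $1\le j_k\le J_k-1$ for $k\ge 2$, and $\Gamma_{h,\infty}=\overline\omega_{h,\infty}\setminus\omega_{h,\infty}$. The finite mesh is $\overline\omega_h=\{x_{\mathbf j}\in\overline\omega_{h,\infty}: j_1\le J_1\}$, with $\omega_h=\{x_{\mathbf j}\in\omega_{h,\infty}: j_1\le J_1-1\}$, $\Gamma_{1h}=\{x_{\mathbf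 j}\in\omega_{h,\infty}: j_1=J_1\}$ and $\Gamma_h=\overline\omega_h\setminus(\omega_h\cup\Gamma_{1h})$. $H_h$ is the space of $W:\overline\omega_{h,\infty}\to\mathbb C$ with $W|_{\Gamma_{h,\infty}}=0$ and $\sum_{\omega_{h,\infty}}|W_{\mathbf j}|^2<\infty$. Let $\partial_k,\bar\partial_k$ be the forward and backward difference quotients in $x_k$ with step $h_k$, $s_{Nk}W_j=\frac1{12}W_{j-1}+\frac56W_j+\frac1{12}W_{j+1}$ (in direction $x_k$), $s_{N1}^-W_j=\frac5{12}W_j+\frac1{12}W_{j-1}$ (in $x_1$), $\overline s_N=\prod_k s_{Nk}$, $\overline s_{N\widehat k}=\prod_{\ell\ne k}s_{N\ell}$, $\overline s_{N\widehat{1k}}=\prod_{\ell\ne1,k}s_{N\ell}$, $\bar\Delta_{hN}=\sum_{k=1}^n\overline s_{N\widehat k}\partial_k\bar\partial_k$. **Hypotheses.** Let $F^m=0$ on $\omega_{h,\infty}\setminus\omega_h$ for $m\ge1$, $\Psi_h^0=0$ on $\omega_{h,\infty}\setminus\omega_h$ and $\Psi_h^0|_{j_1=J_1-1}=0$. Let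 $(\breve\Psi^m,\widetilde\Psi^m,\Psi^m)$ be the solution, with $\Psi^m\in H_h$ for all $m\ge0$, of the scheme: for all $m\ge1$, on $\omega_{h,\infty}$, $$ i\hbar\frac{\breve\Psi^m-\Psi^{m-1}}{\tau/2}=\Delta V\frac{\breve\Psi^m+\Psi^{m-1}}2,\qquad i\hbar\frac{\Psi^m-\widetilde\Psi^m}{\tau/2}=\Delta V\frac{\Psi^m+\widetilde\Psi^m}2,$$ $$ i\hbar\,\overline s_N\frac{\widetilde\Psi^m-\breve\Psi^m}{\tau}=-c_\hbar\bar\Delta_{hN}\frac{\widetilde\Psi^m+\breve\Psi^m}2+\overline s_N\Bigl(\widetilde V\frac{\widetilde\Psi^m+\breve\Psi^m}2\Bigr)+F^m,$$ with $\breve\Psi^m=\widetilde\Psi^m=\Psi^m=0$ on $\Gamma_{h,\infty}$ for $m\ge1$ and $\Psi^0=\Psi^0_h$ on $\overline\omega_{h,\infty}$. **Conclusion.** Then it satisfies the scheme on the finite mesh: for all $m\ge1$, the first two equations hold on $\omega_h\cup\Gamma_{1h}$, the third holds on $\omega_h$, $\breve\Psi^m=\widetilde\Psi^m=\Psi^m=0$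 on $\Gamma_h$, $\Psi^0=\Psi_h^0$ on $\overline\omega_h$, and on $\Gamma_{1h}$ the discrete transparent boundary condition holds: $$ c_\hbar\overline s_{N\widehat1}\bar\partial_1\frac{\widetilde\Psi^m+\breve\Psi^m}2-h_1s_{N1}^-\Bigl\{i\hbar\overline s_{N\widehat1}\frac{\widetilde\Psi^m-\breve\Psi^m}\tau+\Bigl[c_\hbar\sum_{k=2}^n\overline s_{N\widehat{1k}}\partial_k\bar\partial_k-V_\infty\overline s_{N\widehat1}\Bigr]\frac{\widetilde\Psi^m+\breve\Psi^m}2\Bigr\}=c_\hbar\,\mathcal S^m_{\rm ref}\widetilde{\mathbf\Psi}^m_{J_1}.$$ Here $\widetilde{\mathbf\Psi}^m_{J_1}=\{0,\widetilde\Psi^1_{J_1},\dots,\widetilde\Psi^m_{J_1}\}$ is the sequence of traces at $j_1=J_1$ (the term of index $0$ is set to be $0$), and for $\Phi^0,\Phi^1,\dots$ depending on $(j_2,\dots,j_n)$ with $\Phi^0=0$ $$\mathcal S^m_{\rm ref}\mathbf\Phi^m=\mathcal F_2^{-1}\cdots\mathcal F_n^{-1}\Bigl[\sigma^{(2)}_{q_2}\cdots\sigma^{(n)}_{q_n}\sum_{p=0}^mR^p[V_{\infty,\mathbf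 q}]\,\Phi^{m-p,\mathbf q}\Bigr],\qquad \Phi^{p,\mathbf q}=(\mathcal F_n\cdots\mathcal F_2\Phi^p)^{(\mathbf q)},$$ where $(\mathcal F_kP)^{(q)}=\frac2{J_k}\sum_{j=1}^{J_k-1}P_j\sin\frac{\pi qj}{J_k}$, $(\mathcal F_k^{-1}P)_j=\sum_{q=1}^{J_k-1}P^{(q)}\sin\frac{\pi qj}{J_k}$, $\lambda^{(k)}_q=\bigl(\frac2{h_k}\sin\frac{\pi qh_k}{2X_k}\bigr)^2$, $\sigma^{(k)}_q=1-\frac13\sin^2\frac{\pi qh_k}{2X_k}$, $V_{\infty,\mathbf q}=V_\infty+c_\hbar\sum_{k=2}^n\lambda^{(k)}_{q_k}/\sigma^{(k)}_{q_k}$. For real $v$ the kernel is given by $R^0[v]=c_1$, $R^1[v]=-c_1\varkappa\mu$ and $$R^m[v]=\frac{2m-3}m\varkappa\mu R^{m-1}[v]-\frac{m-3}m\varkappa^2R^{m-2}[v]\quad(m\ge2),$$ $$c_1=-\frac{|\alpha|^{1/2}}2e^{-i(\arg\alpha)/2},\quad \varkappa=-e^{i\arg\alpha},\quad \mu=\frac\beta{|\alpha|},\quad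 \alpha=2a+\tfrac23h_1^2a^2,\quad \beta=2\,{\rm Re}\,a+\tfrac23h_1^2|a|^2,\quad a=\frac v{2c_\hbar}+i\frac\hbar{\tau c_\hbar},$$ with $\arg\alpha\in[0,2\pi)$. Moreover, for every real $v$, $\alpha\ne0$, $\arg\alpha\in(0,2\pi)$ and $\mu\in(-1,1)$. -/

import Mathlib

noncomputable section

namespace SplitTBC

/-- The data of the problem in `n = d + 1` space dimensions. The leading direction `x₁` has
index `0 : Fin (d + 1)`, the transverse directions `x₂, …, xₙ` have the indices `k.succ`,
`k : Fin d`. -/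
structure Data (d : ℕ) where
  /-- Planck's constant -/
  hbar : ℝ
  /-- the mass -/
  m0 : ℝ
  /-- the step of the uniform time mesh -/
  tau : ℝ
  /-- for `x₁ ≥ X0` the potentials are constant -/
  X0 : ℝ
  /-- the constant value of the potentials for `x₁ ≥ X0` -/
  Vinf : ℝ
  /-- the lengths `X₁, …, Xₙ` -/
  X : Fin (d + 1) → ℝ
  /-- the numbers `J₁, …, Jₙ` of mesh steps -/
  J : Fin (d + 1) → ℕ
  /-- the potential `V(x)` -/
  V : (Fin (d + 1) → ℝ) → ℝ
  /-- the auxiliary potential `Ṽ(x₁)` -/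
  Vt : ℝ → ℝ

/-- Mesh functions. The node `x_𝐣 = (j₁ h₁, …, jₙ hₙ)` is represented by its multi-index `𝐣`.
Only the values at nodes of the meshes below are ever used. -/
abbrev MeshFn (d : ℕ) : Type := (Fin (d + 1) → ℤ) → ℂ

/-- Functions of the transverse multi-index `(j₂, …, jₙ)` or `(q₂, …, qₙ)`. -/
abbrev TransFn (d : ℕ) : Type := (Fin d → ℤ) → ℂ

namespace Data

variable {d : ℕ} (D : Data d)

/-- The mesh step `h_k = X_k / J_k`. -/
def step (k : Fin (d + 1)) : ℝ := D.X k / (D.J k : ℝ)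

/-- The point `x_𝐣`. -/
def node (j : Fin (d + 1) → ℤ) : Fin (d + 1) → ℝ := fun k => (j k : ℝ) * D.step k

/-- `c_ħ = ħ² / (2 m₀)`. -/
def ch : ℝ := D.hbar ^ 2 / (2 * D.m0)

/-- The standing assumptions on the data. -/
structure Admissible : Prop where
  hbar_pos : 0 < D.hbar
  m0_pos : 0 < D.m0
  tau_pos : 0 < D.tau
  X_pos : ∀ k, 0 < D.X k
  J_pos : ∀ k, 1 ≤ D.J k
  X0_pos : 0 < D.X0
  X0_lt : D.X0 < D.X 0
  two_steps : 2 * D.step 0 ≤ D.X 0 - D.X0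
  V_const : ∀ x : Fin (d + 1) → ℝ, D.X0 ≤ x 0 →
    (∀ k : Fin d, 0 < x k.succ ∧ x k.succ < D.X k.succ) → D.V x = D.Vinf
  Vt_const : ∀ s : ℝ, D.X0 ≤ s → D.Vt s = D.Vinf

/-! ### Meshes -/

/-- The closed infinite mesh. -/
def meshInf : Set (Fin (d + 1) → ℤ) :=
  {j | 0 ≤ j 0 ∧ ∀ k : Fin d, 0 ≤ j k.succ ∧ j k.succ ≤ (D.J k.succ : ℤ)}

/-- The internal part `ω_{h,∞}` of the infinite mesh. -/
def intInf : Set (Fin (d + 1) → ℤ) :=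
  {j | 1 ≤ j 0 ∧ ∀ k : Fin d, 1 ≤ j k.succ ∧ j k.succ ≤ (D.J k.succ : ℤ) - 1}

/-- The boundary `Γ_{h,∞}` of the infinite mesh. -/
def bdryInf : Set (Fin (d + 1) → ℤ) := D.meshInf \ D.intInf

/-- The closed finite mesh. -/
def meshFin : Set (Fin (d + 1) → ℤ) := {j | j ∈ D.meshInf ∧ j 0 ≤ (D.J 0 : ℤ)}

/-- The internal part `ω_h` of the finite mesh. -/
def intFin : Set (Fin (d + 1) → ℤ) := {j | j ∈ D.intInf ∧ j 0 ≤ (D.J 0 : ℤ) - 1}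

/-- The artificial boundary `Γ_{1h}`, at `x₁ = X₁`. -/
def artBdry : Set (Fin (d + 1) → ℤ) := {j | j ∈ D.intInf ∧ j 0 = (D.J 0 : ℤ)}

/-- The remaining part `Γ_h` of the boundary of the finite mesh. -/
def bdryFin : Set (Fin (d + 1) → ℤ) := (D.meshFin \ D.intFin) \ D.artBdry

/-- Membership in the space `H_h`: zero boundary values and square summability. -/
def MemHh (W : MeshFn d) : Prop :=
  (∀ j ∈ D.bdryInf, W j = 0) ∧ Summable fun j : D.intInf => ‖W j‖ ^ 2

/-! ### Difference operators -/

/-- The shift `W_𝐣 ↦ W_{𝐣 + a e_k}`. -/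
def shift (k : Fin (d + 1)) (a : ℤ) : Module.End ℂ (MeshFn d) :=
  LinearMap.funLeft ℂ ℂ fun j => j + Pi.single k a

/-- The backward difference quotient in `x_k`. -/
def bwd (k : Fin (d + 1)) : Module.End ℂ (MeshFn d) :=
  ((D.step k : ℂ)⁻¹) • (1 - shift k (-1))

/-- The forward difference quotient in `x_k`. -/
def fwd (k : Fin (d + 1)) : Module.End ℂ (MeshFn d) :=
  ((D.step k : ℂ)⁻¹) • (shift k 1 - 1)

/-- The Numerov average `s_{Nk}`. -/
def sN (k : Fin (d + 1)) : Module.End ℂ (MeshFn d) :=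
  (1 / 12 : ℂ) • shift k (-1) + (5 / 6 : ℂ) • 1 + (1 / 12 : ℂ) • shift k 1

/-- The one-sided average `s_{N1}^-`. -/
def sN1minus : Module.End ℂ (MeshFn d) :=
  (5 / 12 : ℂ) • 1 + (1 / 12 : ℂ) • shift 0 (-1)

/-- The product of the `s_{Nℓ}` over all directions `ℓ` with `p ℓ`. -/
def sNprod (p : Fin (d + 1) → Prop) [DecidablePred p] : Module.End ℂ (MeshFn d) :=
  (((List.finRange (d + 1)).filter fun l => p l).map sN).prod

/-- The average over all directions. -/
def sBar : Module.End ℂ (MeshFn d) := sNprod fun _ => True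

/-- The average over all directions but `k`. -/
def sBarHat (k : Fin (d + 1)) : Module.End ℂ (MeshFn d) := sNprod fun l => l ≠ k

/-- The average over all directions but `x₁` and `x_k`. -/
def sBarHat1 (k : Fin (d + 1)) : Module.End ℂ (MeshFn d) := sNprod fun l => l ≠ 0 ∧ l ≠ k

/-- The Numerov type Laplacian with splitting averages, `Σ_k s̄_{N,k̂} ∂_k ∂̄_k`. -/
def lapN : Module.End ℂ (MeshFn d) :=
  ∑ k : Fin (d + 1), sBarHat k * (D.fwd k * D.bwd k)

/-- `Σ_{2 ≤ k ≤ n} s̄_{N,1̂k̂} ∂_k ∂̄_k`. -/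
def lapNTrans : Module.End ℂ (MeshFn d) :=
  ∑ k : Fin d, sBarHat1 k.succ * (D.fwd k.succ * D.bwd k.succ)

/-- Multiplication by `Ṽ(x₁)`. -/
def mulVt (W : MeshFn d) : MeshFn d := fun j => (D.Vt (D.node j 0) : ℂ) * W j

/-- `ΔV = V - Ṽ` at the nodes. -/
def deltaV (j : Fin (d + 1) → ℤ) : ℝ := D.V (D.node j) - D.Vt (D.node j 0)

/-! ### The equations of one time step -/

/-- The half step `iħ (W - U) / (τ/2) = ΔV (W + U) / 2` at a node. -/
def HalfStep (U W : MeshFn d) (j : Fin (d + 1) → ℤ) : Prop :=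
  Complex.I * D.hbar * ((W j - U j) / ((D.tau : ℂ) / 2)) =
    (D.deltaV j : ℂ) * ((W j + U j) / 2)

/-- The main step from `B` (breve) to `T` (tilde), with the free term `G`, at a node. -/
def MainStep (G B T : MeshFn d) (j : Fin (d + 1) → ℤ) : Prop :=
  Complex.I * D.hbar * sBar ((D.tau : ℂ)⁻¹ • (T - B)) j =
    -(D.ch : ℂ) * D.lapN ((1 / 2 : ℂ) • (T + B)) j
      + sBar (D.mulVt ((1 / 2 : ℂ) • (T + B))) j + G j

/-- `(B, T, Ψ)` (breve, tilde, and the main unknown) solves the splitting scheme on the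
infinite mesh. -/
structure SolvesInf (F : ℕ → MeshFn d) (Psi0 : MeshFn d) (B T Psi : ℕ → MeshFn d) : Prop where
  first : ∀ m, 1 ≤ m → ∀ j ∈ D.intInf, D.HalfStep (Psi (m - 1)) (B m) j
  main : ∀ m, 1 ≤ m → ∀ j ∈ D.intInf, D.MainStep (F m) (B m) (T m) j
  last : ∀ m, 1 ≤ m → ∀ j ∈ D.intInf, D.HalfStep (T m) (Psi m) j
  bdry : ∀ m, 1 ≤ m → ∀ j ∈ D.bdryInf, B m j = 0 ∧ T m j = 0 ∧ Psi m j = 0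
  init : ∀ j ∈ D.meshInf, Psi 0 j = Psi0 j

/-! ### The discrete transparent boundary condition -/

/-- The trace on `Γ_{1h}`, as a function of `(j₂, …, jₙ)`. -/
def trace (W : MeshFn d) : TransFn d := fun j => W (Fin.cons (D.J 0 : ℤ) j)

/-- The operator on the left of the discrete transparent boundary condition. -/
def D1h (T B : MeshFn d) : MeshFn d :=
  (D.ch : ℂ) • sBarHat 0 (D.bwd 0 ((1 / 2 : ℂ) • (T + B)))
    - (D.step 0 : ℂ) • sN1minus
        ((Complex.I * D.hbar) • sBarHat 0 ((D.tau : ℂ)⁻¹ • (T - B))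
          + ((D.ch : ℂ) • D.lapNTrans ((1 / 2 : ℂ) • (T + B))
            - (D.Vinf : ℂ) • sBarHat 0 ((1 / 2 : ℂ) • (T + B))))

/-- The discrete sine transform in the `k`-th transverse direction. -/
def sineF (k : Fin d) (P : TransFn d) : TransFn d := fun q =>
  (2 / (D.J k.succ : ℂ)) * ∑ j ∈ Finset.Ico 1 (D.J k.succ),
    P (Function.update q k (j : ℤ)) *
      (Real.sin (Real.pi * (q k : ℝ) * (j : ℝ) / (D.J k.succ : ℝ)) : ℂ)

/-- The inverse discrete sine transform in the `k`-th transverse direction. -/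
def sineFinv (k : Fin d) (P : TransFn d) : TransFn d := fun j =>
  ∑ q ∈ Finset.Ico 1 (D.J k.succ),
    P (Function.update j k (q : ℤ)) *
      (Real.sin (Real.pi * (q : ℝ) * (j k : ℝ) / (D.J k.succ : ℝ)) : ℂ)

/-- `ℱₙ ⋯ ℱ₂`. -/
def sineFAll (P : TransFn d) : TransFn d :=
  (List.finRange d).foldl (fun Q k => D.sineF k Q) P

/-- `ℱ₂⁻¹ ⋯ ℱₙ⁻¹`. -/
def sineFinvAll (P : TransFn d) : TransFn d :=
  (List.finRange d).foldr (fun k Q => D.sineFinv k Q) P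

/-- The eigenvalue `λ_q^{(k)}` of `-∂_k ∂̄_k`. -/
def lam (k : Fin (d + 1)) (q : ℤ) : ℝ :=
  (2 / D.step k * Real.sin (Real.pi * (q : ℝ) * D.step k / (2 * D.X k))) ^ 2

/-- The eigenvalue `σ_q^{(k)}` of `s_{Nk}`. -/
def sig (k : Fin (d + 1)) (q : ℤ) : ℝ :=
  1 - 1 / 3 * Real.sin (Real.pi * (q : ℝ) * D.step k / (2 * D.X k)) ^ 2

/-- `V_{∞,𝐪}`. -/
def Vq (q : Fin d → ℤ) : ℝ :=
  D.Vinf + D.ch * ∑ k : Fin d, D.lam k.succ (q k) / D.sig k.succ (q k)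

/-- The argument of a complex number in `[0, 2π)`. -/
def argPos (z : ℂ) : ℝ := if 0 ≤ z.arg then z.arg else z.arg + 2 * Real.pi

theorem norm_mul_exp_argPos (z : ℂ) :
    (‖z‖ : ℂ) * Complex.exp (argPos z * Complex.I) = z := by
  unfold argPos
  split_ifs
  · exact Complex.norm_mul_exp_arg_mul_I z
  · push_cast
    rw [add_mul, Complex.exp_add, Complex.exp_two_pi_mul_I, mul_one]
    exact Complex.norm_mul_exp_arg_mul_I z

/-- The coefficient `a` for the constant potential `v`. -/
def kerA (v : ℝ) : ℂ := (v / (2 * D.ch) : ℝ) + Complex.I * (D.hbar / (D.tau * D.ch) : ℝ)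

/-- The coefficient `α`. -/
def kerAlpha (v : ℝ) : ℂ :=
  2 * D.kerA v + 2 / 3 * (D.step 0 : ℂ) ^ 2 * D.kerA v ^ 2

/-- The coefficient `β`. -/
def kerBeta (v : ℝ) : ℝ :=
  2 * (D.kerA v).re + 2 / 3 * D.step 0 ^ 2 * ‖D.kerA v‖ ^ 2

/-- The coefficient `μ`. -/
def kerMu (v : ℝ) : ℝ := D.kerBeta v / ‖D.kerAlpha v‖

/-- The coefficient `ϰ`. -/
def kerKappa (v : ℝ) : ℂ := -Complex.exp (Complex.I * argPos (D.kerAlpha v))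

/-- The coefficient `c₁`. -/
def kerC1 (v : ℝ) : ℂ :=
  -((Real.sqrt ‖D.kerAlpha v‖ : ℂ) / 2) *
    Complex.exp (-Complex.I * (argPos (D.kerAlpha v) / 2))

/-- The kernel `R^m[v]`. -/
def ker (v : ℝ) : ℕ → ℂ
  | 0 => D.kerC1 v
  | 1 => -D.kerC1 v * D.kerKappa v * D.kerMu v
  | m + 2 =>
      (2 * ((m + 2 : ℕ) : ℂ) - 3) / ((m + 2 : ℕ) : ℂ) * D.kerKappa v * D.kerMu v * ker v (m + 1)
        - (((m + 2 : ℕ) : ℂ) - 3) / ((m + 2 : ℕ) : ℂ) * D.kerKappa v ^ 2 * ker v m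

/-- The discrete convolution `(R * Q)^m`. -/
def conv (R Q : ℕ → ℂ) (m : ℕ) : ℂ := ∑ p ∈ Finset.range (m + 1), R p * Q (m - p)

/-- The operator `𝒮_ref^m`, applied to `Φ⁰, …, Φ^m`. -/
def Sref (m : ℕ) (Phi : ℕ → TransFn d) : TransFn d :=
  D.sineFinvAll fun q =>
    (∏ k : Fin d, (D.sig k.succ (q k) : ℂ)) *
      conv (D.ker (D.Vq q)) (fun p => D.sineFAll (Phi p) q) m

/-- The sequence of traces of `T⁰, T¹, …` on `Γ_{1h}`, where `T⁰ := 0`: the scheme does not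
involve `T⁰`, and `𝒮_ref` acts on sequences with zero initial term. -/
def traceSeq (T : ℕ → MeshFn d) : ℕ → TransFn d :=
  fun p => if p = 0 then 0 else D.trace (T p)

/-- `(B, T, Ψ)` solves the splitting scheme on the finite mesh with the discrete transparent
boundary condition at `x₁ = X₁`. -/
structure SolvesFin (F : ℕ → MeshFn d) (Psi0 : MeshFn d) (B T Psi : ℕ → MeshFn d) : Prop where
  first : ∀ m, 1 ≤ m → ∀ j ∈ D.intFin ∪ D.artBdry, D.HalfStep (Psi (m - 1)) (B m) j
  main : ∀ m, 1 ≤ m → ∀ j ∈ D.intFin, D.MainStep (F m) (B m) (T m) j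
  last : ∀ m, 1 ≤ m → ∀ j ∈ D.intFin ∪ D.artBdry, D.HalfStep (T m) (Psi m) j
  bdry : ∀ m, 1 ≤ m → ∀ j ∈ D.bdryFin, B m j = 0 ∧ T m j = 0 ∧ Psi m j = 0
  tbc : ∀ m, 1 ≤ m → ∀ j ∈ D.artBdry,
    D.D1h (T m) (B m) j = (D.ch : ℂ) * D.Sref m (D.traceSeq T) (Fin.tail j)
  init : ∀ j ∈ D.meshFin, Psi 0 j = Psi0 j

end Data

end SplitTBC

end

noncomputable section

namespace SplitTBC

open PowerSeries

/-! Except for the boundary condition, the finite scheme is a restriction of the infinite one. For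
`j 0 ≥ J 0 - 1` both half steps are the identity, since there `ΔV = 0`, so the breve function at
level `m + 1` is the tilde function at level `m`, with zero as the initial tilde function
(`SolvesInf.breve_eq`). Only the main step with constant potential is left.

The transverse sine transform diagonalizes that step. Each transverse average acts as a nonzero
scalar, and the transverse Laplacian only changes the potential from `Vinf` to `Vq q`
(`SolvesInf.coef_equation`). Every Fourier coefficient then solves a Numerov–Crank–Nicolson problem
on a half-line and tends to zero at infinity.

On the half-line, pass to generating series in time. With `a = kerA v` and `b = conj a + a X`, the
equation becomes the three-term recurrence `h² b (w₀ + 10 w₁ + w₂) = 6 (1 + X) (w₀ - 2 w₁ + w₂)`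
along the mesh. Its characteristic roots are `p / q` and `q / p`, where `p = 2 R + h b`, `q = 2 R -
h b` and `12 R² = b (6 (1 + X) + 2 h² b)`. The kernel recurrence says exactly that its generating
series is such an `R` (`Admissible.mk_ker_sq`, `four_mul_kerCoeffs`), and the choice of argument in
`(0, 2π)` fixes the sign so that `|p₀| ≤ |q₀|` (`Admissible.norm_le_norm`). Decay excludes the root
`q / p` (`eq_zero_of_mul_eq_mul`), so `q w₁ = p w₀`. This relation is the boundary condition for one
mode (`Admissible.transparent_one_dim`), and summing over the modes gives the theorem
(`SolvesInf.transparent`). -/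

/-! ### Formal power series in the time variable. -/

/-- The quotient `f / P` has zero derivative, hence is constant in characteristic zero. -/
theorem eq_C_mul_of_mul_derivative_eq {f P : ℂ⟦X⟧} (hP : constantCoeff P = 1)
    (h : P * derivative ℂ f = derivative ℂ P * f) :
    f = C (constantCoeff f) * P := by
  have hP0 : constantCoeff P ≠ 0 := by simp [hP]
  have hinv : P * P⁻¹ = 1 := PowerSeries.mul_inv_cancel P hP0
  have hd : derivative ℂ (f * P⁻¹) = derivative ℂ (C (constantCoeff f)) := by
    rw [Derivation.leibniz, derivative_inv', derivative_C]
    simp only [smul_eq_mul]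
    linear_combination (P⁻¹ ^ 2) * h - (P⁻¹ * derivative ℂ f) * hinv
  have := PowerSeries.derivative.ext hd (by simp [hP])
  rw [← this]
  linear_combination (-f) * hinv

/-- A sequence with the three-term recurrence of the Legendre type has the generating function
`r 0 * √(1 - 2 κ μ z + κ² z²)`. -/
theorem mk_sq_of_recurrence (r : ℕ → ℂ) (κ μ : ℂ) (h1 : r 1 = -r 0 * κ * μ)
    (h2 : ∀ m : ℕ, ((m : ℂ) + 2) * r (m + 2) =
      (2 * m + 1) * κ * μ * r (m + 1) - ((m : ℂ) - 1) * κ ^ 2 * r m) :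
    (mk r) ^ 2 = C (r 0 ^ 2) * (1 - C (2 * κ * μ) * X + C (κ ^ 2) * X ^ 2) := by
  set P : ℂ⟦X⟧ := 1 - C (2 * κ * μ) * X + C (κ ^ 2) * X ^ 2 with hP
  have hdP : derivative ℂ P = -C (2 * κ * μ) + C (2 * κ ^ 2) * X := by
    rw [hP]
    simp only [map_add, map_sub, Derivation.leibniz, derivative_C, derivative_X,
      Derivation.leibniz_pow, Derivation.map_one_eq_zero, smul_eq_mul, map_mul (C (R := ℂ)) 2 (κ ^ 2),
      map_ofNat, nsmul_eq_mul]
    push_cast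
    ring
  -- Coefficient by coefficient this equation is the recurrence; it says that the square of the
  -- series has the same logarithmic derivative as `P`.
  have hode : 2 * P * derivative ℂ (mk r) = derivative ℂ P * mk r := by
    have e1 : 2 * P * derivative ℂ (mk r) = C 2 * derivative ℂ (mk r)
        - C (4 * κ * μ) * (X * derivative ℂ (mk r))
        + C (2 * κ ^ 2) * (X * (X * derivative ℂ (mk r))) := by
      rw [hP]; simp only [map_mul, map_ofNat, map_pow]; ring
    have e2 : derivative ℂ P * mk r =
        C (-(2 * κ * μ)) * mk r + C (2 * κ ^ 2) * (X * mk r) := by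
      rw [hdP]; simp only [map_neg]; ring
    rw [e1, e2]
    ext n
    simp only [map_add, map_sub, coeff_C_mul]
    rcases n with _ | _ | n
    · simp only [coeff_zero_X_mul, coeff_derivative, coeff_mk]
      push_cast; simp only [zero_add]; rw [h1]; ring
    · have := h2 0
      simp only [zero_add, coeff_succ_X_mul, coeff_zero_X_mul, coeff_derivative, coeff_mk]
      simp only [zero_add, Nat.cast_zero, Nat.cast_one] at this ⊢
      linear_combination 2 * this
    · have := h2 (n + 1)
      simp only [coeff_succ_X_mul, coeff_derivative, coeff_mk]
      push_cast at this ⊢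
      linear_combination 2 * this
  have key := eq_C_mul_of_mul_derivative_eq (f := (mk r) ^ 2) (P := P) (by simp [hP]) (by
    rw [pow_two, Derivation.leibniz]
    simp only [smul_eq_mul]
    linear_combination (mk r) * hode)
  simpa using key

theorem coeff_mul_of_forall_lt {p f : ℂ⟦X⟧} {m : ℕ} (h : ∀ k < m, coeff k f = 0) :
    coeff m (p * f) = constantCoeff p * coeff m f := by
  rw [coeff_mul, Finset.sum_eq_single (0, m)]
  · simp
  · rintro ⟨i, j⟩ hij hne
    rw [Finset.HasAntidiagonal.mem_antidiagonal] at hij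
    have hj : j < m := by
      simp only at hij
      rcases Nat.eq_zero_or_pos i with rfl | hi
      · exact absurd (by simpa using hij) (fun h : j = m => hne (by rw [h]))
      · omega
    simp [h j hj]
  · intro h; exact absurd (by simp) h

open Filter Topology in
/-- A formal geometric progression whose ratio is at least one cannot decay. -/
theorem eq_zero_of_mul_eq_mul {p q : ℂ⟦X⟧} (hpq : ‖constantCoeff p‖ ≤ ‖constantCoeff q‖)
    (hq : constantCoeff q ≠ 0) {w : ℕ → ℂ⟦X⟧} (h : ∀ x, p * w (x + 1) = q * w x)
    (hlim : ∀ m, Tendsto (fun x => coeff m (w x)) atTop (𝓝 0)) (x : ℕ) : w x = 0 := by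
  suffices H : ∀ m x, coeff m (w x) = 0 by ext m; simpa using H m x
  intro m
  induction m using Nat.strong_induction_on with
  | _ m ih =>
    have hq' : 0 < ‖constantCoeff q‖ := norm_pos_iff.2 hq
    -- With the lower coefficients already zero, only the constant coefficients of `p` and `q` act
    -- on the `m`-th one, so its norm cannot decrease in `x`; a monotone sequence with limit zero is
    -- nonpositive.
    have hmono : Monotone fun x => ‖coeff m (w x)‖ := by
      refine monotone_nat_of_le_succ fun x => ?_
      have e := congrArg (coeff m) (h x)
      rw [coeff_mul_of_forall_lt fun k hk => ih k hk _,
        coeff_mul_of_forall_lt fun k hk => ih k hk _] at e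
      have e' := congrArg norm e
      rw [norm_mul, norm_mul] at e'
      have : ‖constantCoeff q‖ * ‖coeff m (w x)‖ ≤ ‖constantCoeff q‖ * ‖coeff m (w (x + 1))‖ := by
        rw [← e']; exact mul_le_mul_of_nonneg_right hpq (norm_nonneg _)
      exact le_of_mul_le_mul_left this hq'
    intro x
    have := hmono.ge_of_tendsto (by simpa using (hlim m).norm) x
    exact norm_le_zero_iff.1 this

open Filter Topology in
theorem tendsto_coeff_mul_mk (p : ℂ⟦X⟧) {u : ℕ → ℕ → ℂ}
    (hlim : ∀ m, Tendsto (fun x => u x m) atTop (𝓝 0)) (m : ℕ) :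
    Tendsto (fun x => coeff m (p * mk (u x))) atTop (𝓝 0) := by
  simp only [coeff_mul, coeff_mk]
  have : Tendsto (fun x => ∑ ij ∈ Finset.HasAntidiagonal.antidiagonal m, coeff ij.1 p * u x ij.2) atTop
      (𝓝 (∑ ij ∈ Finset.HasAntidiagonal.antidiagonal m, coeff ij.1 p * 0)) :=
    tendsto_finsetSum _ fun ij _ => (hlim ij.2).const_mul _
  simpa using this

/-! ### The coefficients of the kernel and the choice of the square root. -/

namespace Data

variable {d : ℕ} {D : Data d}

theorem Admissible.ch_pos (hD : D.Admissible) : 0 < D.ch := by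
  have := hD.hbar_pos; have := hD.m0_pos; unfold ch; positivity

theorem Admissible.step_pos (hD : D.Admissible) (k : Fin (d + 1)) : 0 < D.step k := by
  have h1 := hD.X_pos k
  have h2 : (0 : ℝ) < D.J k := by exact_mod_cast hD.J_pos k
  unfold step; positivity

theorem kerA_re (v : ℝ) : (D.kerA v).re = v / (2 * D.ch) := by
  simp [kerA, -Complex.ofReal_div, -Complex.ofReal_mul]

theorem kerA_im (v : ℝ) : (D.kerA v).im = D.hbar / (D.tau * D.ch) := by
  simp [kerA, -Complex.ofReal_div, -Complex.ofReal_mul]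

theorem Admissible.kerA_im_pos (hD : D.Admissible) (v : ℝ) : 0 < (D.kerA v).im := by
  have := hD.hbar_pos; have := hD.tau_pos; have := hD.ch_pos
  rw [kerA_im]; positivity

theorem kerAlpha_re (v : ℝ) : (D.kerAlpha v).re =
    2 * (D.kerA v).re + 2 / 3 * D.step 0 ^ 2 * ((D.kerA v).re ^ 2 - (D.kerA v).im ^ 2) := by
  have : D.kerAlpha v = ((2 : ℝ) : ℂ) * D.kerA v
      + ((2 / 3 * D.step 0 ^ 2 : ℝ) : ℂ) * (D.kerA v * D.kerA v) := by
    simp only [kerAlpha]; push_cast; ring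
  rw [this, Complex.add_re, Complex.re_ofReal_mul, Complex.re_ofReal_mul, Complex.mul_re]; ring

theorem kerAlpha_im (v : ℝ) : (D.kerAlpha v).im =
    2 * (D.kerA v).im + 4 / 3 * D.step 0 ^ 2 * ((D.kerA v).re * (D.kerA v).im) := by
  have : D.kerAlpha v = ((2 : ℝ) : ℂ) * D.kerA v
      + ((2 / 3 * D.step 0 ^ 2 : ℝ) : ℂ) * (D.kerA v * D.kerA v) := by
    simp only [kerAlpha]; push_cast; ring
  rw [this, Complex.add_im, Complex.im_ofReal_mul, Complex.im_ofReal_mul, Complex.mul_im]; ring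

/-- Write `a = r + i s` with `s > 0`. A zero imaginary part forces `h₁² r = -3/2`, and the real part
becomes `r - (2/3) h₁² s²`. So `α` avoids the half-line `[0, ∞)`, which gives both `α ≠ 0` and an
argument strictly inside `(0, 2π)`. -/
theorem Admissible.kerAlpha_re_neg_of_im_eq_zero (hD : D.Admissible) (v : ℝ)
    (h : (D.kerAlpha v).im = 0) : (D.kerAlpha v).re < 0 := by
  have hs := hD.kerA_im_pos v
  have hh := hD.step_pos 0
  rw [kerAlpha_im] at h
  rw [kerAlpha_re]
  generalize (D.kerA v).re = r at *
  generalize (D.kerA v).im = s at *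
  generalize D.step 0 = h1 at *
  have h0 : 2 + 4 / 3 * h1 ^ 2 * r = 0 := by
    have : s * (2 + 4 / 3 * h1 ^ 2 * r) = 0 := by linarith
    rcases mul_eq_zero.1 this with h | h
    · exact absurd h hs.ne'
    · exact h
  have hr : r < 0 := by
    by_contra hr
    push Not at hr
    have : 0 ≤ 4 / 3 * h1 ^ 2 * r := by positivity
    linarith
  have : 0 < h1 ^ 2 * s ^ 2 := by positivity
  have e : 2 / 3 * h1 ^ 2 * r ^ 2 = -r := by linear_combination (r / 2) * h0
  linarith

theorem Admissible.kerAlpha_ne_zero (hD : D.Admissible) (v : ℝ) : D.kerAlpha v ≠ 0 := by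
  intro h
  have := hD.kerAlpha_re_neg_of_im_eq_zero v (by simp [h])
  simp [h] at this

theorem Admissible.argPos_kerAlpha_mem (hD : D.Admissible) (v : ℝ) :
    argPos (D.kerAlpha v) ∈ Set.Ioo 0 (2 * Real.pi) := by
  have h1 := Complex.neg_pi_lt_arg (D.kerAlpha v)
  have h2 := Complex.arg_le_pi (D.kerAlpha v)
  have hpi := Real.pi_pos
  have h0 : (D.kerAlpha v).arg ≠ 0 := by
    intro h
    rw [Complex.arg_eq_zero_iff] at h
    exact absurd (hD.kerAlpha_re_neg_of_im_eq_zero v h.2) (not_lt.2 h.1)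
  unfold argPos
  split_ifs with h
  · exact ⟨lt_of_le_of_ne h h0.symm, by linarith⟩
  · exact ⟨by linarith, by linarith⟩

theorem Admissible.kerMu_mem (hD : D.Admissible) (v : ℝ) : D.kerMu v ∈ Set.Ioo (-1 : ℝ) 1 := by
  have hα : 0 < ‖D.kerAlpha v‖ := norm_pos_iff.2 (hD.kerAlpha_ne_zero v)
  have hs := hD.kerA_im_pos v
  -- The difference of the two sides is exactly `4 (Im a)²`.
  have hlt : D.kerBeta v ^ 2 < ‖D.kerAlpha v‖ ^ 2 := by
    rw [Complex.sq_norm, Complex.normSq_apply, kerAlpha_re, kerAlpha_im, kerBeta, Complex.sq_norm,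
      Complex.normSq_apply]
    generalize (D.kerA v).re = r at *
    generalize (D.kerA v).im = s at *
    have : 0 < s ^ 2 := by positivity
    linarith [this]
  have := abs_lt_of_sq_lt_sq hlt hα.le
  rw [abs_lt] at this
  unfold kerMu
  exact ⟨by rw [lt_div_iff₀ hα]; linarith, by rw [div_lt_iff₀ hα]; linarith⟩

open ComplexConjugate in
theorem kerC1_sq (v : ℝ) : 4 * D.kerC1 v ^ 2 = conj (D.kerAlpha v) := by
  have h1 : ((Real.sqrt ‖D.kerAlpha v‖ : ℂ)) ^ 2 = ‖D.kerAlpha v‖ := by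
    rw [← Complex.ofReal_pow, Real.sq_sqrt (norm_nonneg _)]
  conv_rhs => rw [← norm_mul_exp_argPos (D.kerAlpha v)]
  rw [map_mul, Complex.conj_ofReal, ← Complex.exp_conj, map_mul, Complex.conj_ofReal,
    Complex.conj_I, kerC1, mul_pow, ← Complex.exp_nat_mul]
  rw [← h1]
  have : ((2 : ℕ) : ℂ) * (-Complex.I * (argPos (D.kerAlpha v) / 2)) =
      argPos (D.kerAlpha v) * -Complex.I := by push_cast; ring
  rw [this]; ring

/-- Half of the argument lies in `(0, π)`, where the sine is positive. This sign singles out one of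
the two square roots of `conj α / 4`. -/
theorem Admissible.kerC1_im_pos (hD : D.Admissible) (v : ℝ) : 0 < (D.kerC1 v).im := by
  have hα : 0 < Real.sqrt ‖D.kerAlpha v‖ :=
    Real.sqrt_pos.2 (norm_pos_iff.2 (hD.kerAlpha_ne_zero v))
  obtain ⟨h1, h2⟩ := hD.argPos_kerAlpha_mem v
  have e : D.kerC1 v = ((-(Real.sqrt ‖D.kerAlpha v‖ / 2) : ℝ) : ℂ) *
      Complex.exp ((-(argPos (D.kerAlpha v) / 2) : ℝ) * Complex.I) := by
    rw [kerC1]; push_cast; ring_nf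
  rw [e, Complex.im_ofReal_mul, Complex.exp_ofReal_mul_I_im, Real.sin_neg]
  have := Real.sin_pos_of_pos_of_lt_pi (x := argPos (D.kerAlpha v) / 2) (by linarith) (by linarith)
  have h3 : 0 < Real.sqrt ‖D.kerAlpha v‖ / 2 := by positivity
  nlinarith

open ComplexConjugate in
theorem Admissible.mk_ker_sq (hD : D.Admissible) (v : ℝ) :
    4 * (PowerSeries.mk (D.ker v)) ^ 2 = C (conj (D.kerAlpha v)) + C (2 * (D.kerBeta v : ℂ)) * PowerSeries.X
      + C (D.kerAlpha v) * PowerSeries.X ^ 2 := by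
  have hN : (‖D.kerAlpha v‖ : ℂ) ≠ 0 := by
    exact_mod_cast (norm_pos_iff.2 (hD.kerAlpha_ne_zero v)).ne'
  have h := mk_sq_of_recurrence (D.ker v) (D.kerKappa v) (D.kerMu v) (by simp [ker]) (fun m => by
    have hm : ((m : ℂ) + 2) ≠ 0 := by exact_mod_cast (Nat.succ_ne_zero (m + 1))
    rw [ker]; push_cast; field_simp; ring)
  have hc : 4 * D.ker v 0 ^ 2 = conj (D.kerAlpha v) := by rw [ker]; exact kerC1_sq v
  have hαe := norm_mul_exp_argPos (D.kerAlpha v)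
  have hκ : conj (D.kerAlpha v) * D.kerKappa v = -‖D.kerAlpha v‖ := by
    conv_lhs => rw [← hαe]
    rw [kerKappa, map_mul, Complex.conj_ofReal, ← Complex.exp_conj, map_mul, Complex.conj_ofReal,
      Complex.conj_I, mul_neg, mul_assoc, ← Complex.exp_add]
    rw [mul_neg, mul_comm Complex.I, neg_add_cancel, Complex.exp_zero, mul_one]
  have hκ2 : -(‖D.kerAlpha v‖ : ℂ) * D.kerKappa v = D.kerAlpha v := by
    conv_rhs => rw [← hαe]
    rw [kerKappa, mul_comm Complex.I]; ring
  have hμ : (‖D.kerAlpha v‖ : ℂ) * D.kerMu v = D.kerBeta v := by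
    rw [kerMu, Complex.ofReal_div, mul_div_cancel₀ _ hN]
  rw [h]
  have k1 : 4 * D.ker v 0 ^ 2 * (2 * D.kerKappa v * D.kerMu v) = -(2 * D.kerBeta v) := by
    rw [hc]; linear_combination (2 * (D.kerMu v : ℂ)) * hκ - 2 * hμ
  have k2 : 4 * D.ker v 0 ^ 2 * (D.kerKappa v ^ 2) = D.kerAlpha v := by
    rw [hc]; linear_combination (D.kerKappa v) * hκ + hκ2
  have hc' := congrArg (C (R := ℂ)) hc
  have k1' := congrArg (C (R := ℂ)) k1
  have k2' := congrArg (C (R := ℂ)) k2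
  simp only [map_mul, map_ofNat, map_pow, map_neg] at hc' k1' k2' ⊢
  linear_combination hc' - k1' * PowerSeries.X + k2' * PowerSeries.X ^ 2

open ComplexConjugate in
/-- The root of the characteristic equation chosen by the kernel is the decaying one. -/
theorem Admissible.norm_le_norm (hD : D.Admissible) (v : ℝ) :
    ‖2 * D.kerC1 v + D.step 0 * conj (D.kerA v)‖ ≤
      ‖2 * D.kerC1 v - D.step 0 * conj (D.kerA v)‖ := by
  have hy := hD.kerC1_im_pos v
  have hs := hD.kerA_im_pos v
  have hh := hD.step_pos 0
  have h4 := kerC1_sq (D := D) v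
  have hre := congrArg Complex.re h4
  have him := congrArg Complex.im h4
  rw [Complex.conj_re, kerAlpha_re] at hre
  rw [Complex.conj_im, kerAlpha_im] at him
  have e4 : ∀ z : ℂ, 4 * z ^ 2 = ((4 : ℝ) : ℂ) * (z * z) := fun z => by push_cast; ring
  rw [e4, Complex.re_ofReal_mul, Complex.mul_re] at hre
  rw [e4, Complex.im_ofReal_mul, Complex.mul_im] at him
  refine le_of_sq_le_sq ?_ (norm_nonneg _)
  rw [Complex.sq_norm, Complex.sq_norm, Complex.normSq_apply, Complex.normSq_apply]
  have e2 : (2 : ℂ) * D.kerC1 v = ((2 : ℝ) : ℂ) * D.kerC1 v := by norm_num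
  simp only [e2, Complex.add_re, Complex.sub_re, Complex.add_im, Complex.sub_im,
    Complex.re_ofReal_mul, Complex.im_ofReal_mul, Complex.conj_re, Complex.conj_im]
  generalize (D.kerA v).re = r at *
  generalize (D.kerA v).im = s at *
  generalize (D.kerC1 v).re = x at *
  generalize (D.kerC1 v).im = y at *
  generalize D.step 0 = k at *
  -- The inequality of norms amounts to `Re (c₁ a) ≤ 0`. If this fails, the real part of `4 c₁² =
  -- conj α` forces `r > 0`, then `x r > y s > 0` gives `x > 0`; but the imaginary part makes `x y`
  -- negative when `r > 0`.
  have main : x * r - y * s ≤ 0 := by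
    by_contra hcon
    push Not at hcon
    have hxy : x * y = -s * (1 / 4 + k ^ 2 * r / 6) := by linarith
    have h1 : 0 < y * (x * r - y * s) := by positivity
    have h2 : y * (x * r - y * s) = s * (-r / 4 - k ^ 2 * r ^ 2 / 6 - y ^ 2) := by
      linear_combination r * hxy
    rw [h2] at h1
    have h3 := pos_of_mul_pos_right h1 hs.le
    have hks : 0 < k ^ 2 * s ^ 2 := by positivity
    have hr : 0 < r := by nlinarith [sq_nonneg x]
    have hys : 0 < y * s := by positivity
    have hx : 0 < x := pos_of_mul_pos_left (by linarith : 0 < x * r) hr.le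
    have : 0 < x * y := by positivity
    have : 0 < s * (1 / 4 + k ^ 2 * r / 6) := by positivity
    linarith
  nlinarith [mul_nonneg hh.le (neg_nonneg.2 main)]

-- The factor `b = conj a + a X` splits off the square of the kernel series. This makes `(2 R + h b)
-- (2 R - h b)` equal to `b (6 (1 + X) - h² b) / 3`, which matches the outer coefficient of the
-- three-term recurrence.
open ComplexConjugate in
theorem four_mul_kerCoeffs (v : ℝ) :
    3 * (C (conj (D.kerAlpha v)) + C (2 * (D.kerBeta v : ℂ)) * PowerSeries.X + C (D.kerAlpha v) * PowerSeries.X ^ 2) =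
      (C (conj (D.kerA v)) + C (D.kerA v) * PowerSeries.X) * (6 * (1 + PowerSeries.X) +
        2 * C (D.step 0 : ℂ) ^ 2 * (C (conj (D.kerA v)) + C (D.kerA v) * PowerSeries.X)) := by
  have e1 : 3 * conj (D.kerAlpha v) = 6 * conj (D.kerA v) +
      2 * (D.step 0 : ℂ) ^ 2 * conj (D.kerA v) ^ 2 := by
    simp only [kerAlpha, map_add, map_mul, map_pow, map_div₀, map_ofNat, Complex.conj_ofReal]; ring
  have e2 : 3 * (2 * (D.kerBeta v : ℂ)) = 6 * (D.kerA v + conj (D.kerA v)) +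
      4 * (D.step 0 : ℂ) ^ 2 * (D.kerA v * conj (D.kerA v)) := by
    rw [Complex.add_conj, Complex.mul_conj, Complex.normSq_eq_norm_sq]
    simp only [kerBeta]; push_cast; ring
  have e3 : 3 * D.kerAlpha v = 6 * D.kerA v + 2 * (D.step 0 : ℂ) ^ 2 * D.kerA v ^ 2 := by
    simp only [kerAlpha]; ring
  have e1' := congrArg (C (R := ℂ)) e1
  have e2' := congrArg (C (R := ℂ)) e2
  have e3' := congrArg (C (R := ℂ)) e3
  simp only [map_mul, map_ofNat, map_pow, map_add] at e1' e2' e3' ⊢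
  linear_combination e1' + e2' * PowerSeries.X + e3' * PowerSeries.X ^ 2

/-! ### The half-line problem. -/

-- Together with `Admissible.potential_eq`, this merges the time difference and the time average
-- into the single symbol `conj a + a X`.
open ComplexConjugate in
theorem Admissible.hbar_div_tau (hD : D.Admissible) (v : ℝ) :
    2 * (Complex.I * D.hbar * (D.tau : ℂ)⁻¹) = D.ch * (D.kerA v - conj (D.kerA v)) := by
  have hτ : (D.tau : ℂ) ≠ 0 := by exact_mod_cast hD.tau_pos.ne'
  have hc : (D.ch : ℂ) ≠ 0 := by exact_mod_cast hD.ch_pos.ne'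
  rw [Complex.sub_conj, kerA_im]
  push_cast
  field_simp

open ComplexConjugate in
theorem Admissible.potential_eq (hD : D.Admissible) (v : ℝ) :
    (v : ℂ) = D.ch * (D.kerA v + conj (D.kerA v)) := by
  have hc : (D.ch : ℂ) ≠ 0 := by exact_mod_cast hD.ch_pos.ne'
  rw [Complex.add_conj, kerA_re]
  push_cast
  field_simp

open Filter Topology ComplexConjugate in
/-- The transparent boundary condition for decaying solutions on a half-line. -/
theorem Admissible.transparent_one_dim (hD : D.Admissible) (v : ℝ) (u : ℕ → ℕ → ℂ)
    (h0 : ∀ x, u x 0 = 0) (hlim : ∀ m, Tendsto (fun x => u x m) atTop (𝓝 0))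
    (heq : ∀ x m, Complex.I * D.hbar * (D.tau : ℂ)⁻¹ *
      (1 / 12 * (u x (m + 1) - u x m) + 5 / 6 * (u (x + 1) (m + 1) - u (x + 1) m) +
        1 / 12 * (u (x + 2) (m + 1) - u (x + 2) m)) =
      -(D.ch : ℂ) * (1 / 2) * (((D.step 0 : ℂ)⁻¹) ^ 2 * ((u x (m + 1) + u x m)
        - 2 * (u (x + 1) (m + 1) + u (x + 1) m) + (u (x + 2) (m + 1) + u (x + 2) m))) +
      (v : ℂ) * (1 / 2) * (1 / 12 * (u x (m + 1) + u x m) + 5 / 6 * (u (x + 1) (m + 1) + u (x + 1) m)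
        + 1 / 12 * (u (x + 2) (m + 1) + u (x + 2) m))) (m : ℕ) :
    (D.ch : ℂ) * ((D.step 0 : ℂ)⁻¹ * (1 / 2) *
        ((u 1 (m + 1) + u 1 m) - (u 0 (m + 1) + u 0 m))) -
      (D.step 0 : ℂ) * (Complex.I * D.hbar * (D.tau : ℂ)⁻¹ *
          (5 / 12 * (u 1 (m + 1) - u 1 m) + 1 / 12 * (u 0 (m + 1) - u 0 m)) -
        (v : ℂ) * (1 / 2) *
          (5 / 12 * (u 1 (m + 1) + u 1 m) + 1 / 12 * (u 0 (m + 1) + u 0 m))) =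
      (D.ch : ℂ) * conv (D.ker v) (u 1) (m + 1) := by
  have hh : (D.step 0 : ℂ) ≠ 0 := by exact_mod_cast (hD.step_pos 0).ne'
  have hc : (D.ch : ℂ) ≠ 0 := by exact_mod_cast hD.ch_pos.ne'
  have hτ := hD.hbar_div_tau v
  have hv := hD.potential_eq v
  set a := D.kerA v with ha
  set h : ℂ := ((D.step 0 : ℝ) : ℂ) with hh'
  set b : ℂ⟦X⟧ := C (conj a) + C a * PowerSeries.X with hb
  set R : ℂ⟦X⟧ := PowerSeries.mk (D.ker v) with hR
  set w : ℕ → ℂ⟦X⟧ := fun x => PowerSeries.mk (u x) with hw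
  have hR2 : 12 * R ^ 2 = b * (6 * (1 + PowerSeries.X) + 2 * C h ^ 2 * b) := by
    rw [← four_mul_kerCoeffs, ← hD.mk_ker_sq]; ring
  have hrec : ∀ x, C h ^ 2 * b * (w x + 10 * w (x + 1) + w (x + 2)) =
      6 * (1 + PowerSeries.X) * (w x - 2 * w (x + 1) + w (x + 2)) := by
    intro x
    have e1 : C h ^ 2 * b * (w x + 10 * w (x + 1) + w (x + 2)) =
        C (h ^ 2 * conj a) * (w x + C 10 * w (x + 1) + w (x + 2)) +
        C (h ^ 2 * a) * (PowerSeries.X * (w x + C 10 * w (x + 1) + w (x + 2))) := by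
      simp only [hb, map_mul, map_pow, map_ofNat]; ring
    have e2 : 6 * (1 + PowerSeries.X) * (w x - 2 * w (x + 1) + w (x + 2)) =
        C 6 * (w x - C 2 * w (x + 1) + w (x + 2)) +
        C 6 * (PowerSeries.X * (w x - C 2 * w (x + 1) + w (x + 2))) := by
      simp only [map_ofNat]; ring
    rw [e1, e2]
    ext m
    -- The scheme says nothing about the coefficient of index zero; there both sides vanish by `h0`.
    rcases m with _ | m
    · simp [hw, h0]
    · have := heq x m
      simp only [map_add, map_sub, coeff_C_mul, coeff_succ_X_mul, hw, coeff_mk]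
      refine mul_left_cancel₀ hc ?_
      have hinv : h ^ 2 * h⁻¹ ^ 2 = 1 := by rw [← mul_pow, mul_inv_cancel₀ hh, one_pow]
      linear_combination (-12 * h ^ 2) * this +
        (1 / 2 * h ^ 2 * ((u x (m + 1) - u x m) + 10 * (u (x + 1) (m + 1) - u (x + 1) m) +
          (u (x + 2) (m + 1) - u (x + 2) m))) * hτ -
        (1 / 2 * h ^ 2 * ((u x (m + 1) + u x m) + 10 * (u (x + 1) (m + 1) + u (x + 1) m) +
          (u (x + 2) (m + 1) + u (x + 2) m))) * hv +
        (6 * D.ch * ((u x (m + 1) + u x m) - 2 * (u (x + 1) (m + 1) + u (x + 1) m) +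
          (u (x + 2) (m + 1) + u (x + 2) m))) * hinv
  set p : ℂ⟦X⟧ := 2 * R + C h * b with hp
  set q : ℂ⟦X⟧ := 2 * R - C h * b with hq
  have hp0 : constantCoeff p = 2 * D.kerC1 v + h * conj a := by
    rw [hp, ← map_ofNat (C (R := ℂ))]; simp [hR, hb, ker]
  have hq0 : constantCoeff q = 2 * D.kerC1 v - h * conj a := by
    rw [hq, ← map_ofNat (C (R := ℂ))]; simp [hR, hb, ker]
  -- Three times the product equals `conj a * (6 - h² conj a)`, and both factors have nonzero
  -- imaginary part.
  have hpq0 : constantCoeff p * constantCoeff q ≠ 0 := by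
    have e : 3 * (constantCoeff p * constantCoeff q) = conj a * (6 - h ^ 2 * conj a) := by
      have := congrArg constantCoeff hR2
      simp only [hR, hb, map_mul, map_pow, map_add, map_ofNat,
        map_one, ← coeff_zero_eq_constantCoeff_apply, coeff_mk] at this
      simp [ker] at this
      rw [hp0, hq0]
      linear_combination this
    intro h0
    rw [h0, mul_zero] at e
    have hs := hD.kerA_im_pos v
    rcases mul_eq_zero.1 e.symm with e | e
    · have := congrArg Complex.im e
      rw [Complex.conj_im, Complex.zero_im] at this
      linarith
    · have := congrArg Complex.im e
      rw [hh', ← Complex.ofReal_pow, Complex.sub_im, Complex.im_ofReal_mul, Complex.conj_im,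
        Complex.zero_im] at this
      have h1 := hD.step_pos 0
      have h2 : 0 < D.step 0 ^ 2 * a.im := by positivity
      have h6 : (6 : ℂ).im = 0 := by simp
      linarith
  -- The combination `g x = q * w (x + 1) - p * w x` removes the mode with ratio `p / q`; the
  -- recurrence leaves `p * g (x + 1) = q * g x`, which is incompatible with decay unless `g = 0`.
  have hwz : ∀ x, q * w (x + 1) - p * w x = 0 := by
    refine eq_zero_of_mul_eq_mul (p := p) (q := q) ?_ (right_ne_zero_of_mul hpq0) ?_ ?_
    · rw [hp0, hq0]; exact hD.norm_le_norm v
    · intro x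
      have h3 : (3 : ℂ⟦X⟧) ≠ 0 := by
        rw [← map_ofNat (C (R := ℂ))]; simp
      refine mul_left_cancel₀ h3 ?_
      rw [hp, hq]
      linear_combination (-b) * hrec x + (w x - 2 * w (x + 1) + w (x + 2)) * hR2
    · intro m
      simp only [map_sub]
      have t1 := tendsto_coeff_mul_mk q (fun m => (hlim m).comp (tendsto_add_atTop_nat 1)) m
      have t2 := tendsto_coeff_mul_mk p hlim m
      simpa [Function.comp_def] using t1.sub t2
  -- After multiplication by `p`, the product `p * w 0` is replaced by `q * w 1`, and the formula
  -- for `R ^ 2` closes the identity. Up to the factor `c_ħ / (12 h)` this is the boundary condition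
  -- for generating series.
  have hfin : 6 * (1 + PowerSeries.X) * (w 1 - w 0) + C h ^ 2 * b * (5 * w 1 + w 0) = 12 * C h * R * w 1 := by
    have hp' : p ≠ 0 := fun h => left_ne_zero_of_mul hpq0 (by simp [h])
    refine mul_left_cancel₀ hp' ?_
    have := hwz 0
    rw [zero_add] at this
    rw [hp, hq] at this
    rw [hp]
    linear_combination (6 * (1 + PowerSeries.X) - C h ^ 2 * b) * this - 2 * C h * w 1 * hR2
  have hconv : coeff (m + 1) (R * w 1) = conv (D.ker v) (u 1) (m + 1) := by
    rw [coeff_mul, Finset.Nat.sum_antidiagonal_eq_sum_range_succ_mk]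
    simp [conv, hR, hw]
  rw [← hconv]
  have e1 : 6 * (1 + PowerSeries.X) * (w 1 - w 0) + C h ^ 2 * b * (5 * w 1 + w 0) =
      C 6 * (w 1 - w 0) + C 6 * (PowerSeries.X * (w 1 - w 0)) + C (h ^ 2 * conj a) * (C 5 * w 1 + w 0)
        + C (h ^ 2 * a) * (PowerSeries.X * (C 5 * w 1 + w 0)) := by
    simp only [hb, map_mul, map_pow, map_ofNat]; ring
  have e2 : 12 * C h * R * w 1 = C (12 * h) * (R * w 1) := by
    simp only [map_mul, map_ofNat]; ring
  have key := congrArg (coeff (m + 1)) hfin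
  rw [e1, e2] at key
  simp only [map_add, map_sub, coeff_C_mul, coeff_succ_X_mul] at key
  generalize coeff (m + 1) (R * w 1) = Z at *
  simp only [hw, coeff_mk] at key
  have hinv : h * h⁻¹ = 1 := mul_inv_cancel₀ hh
  linear_combination (D.ch * h⁻¹ / 12) * key -
    (h / 24 * (5 * (u 1 (m + 1) - u 1 m) + (u 0 (m + 1) - u 0 m))) * hτ +
    (h / 24 * (5 * (u 1 (m + 1) + u 1 m) + (u 0 (m + 1) + u 0 m))) * hv +
    (D.ch * Z - h * D.ch / 12 * (conj a * (5 * u 1 (m + 1) + u 0 (m + 1)) +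
      a * (5 * u 1 m + u 0 m))) * hinv

end Data

/-! ### Trigonometric sums. -/

theorem two_mul_sin_mul_sum_cos (x : ℝ) (N : ℕ) :
    2 * Real.sin (x / 2) * ∑ q ∈ Finset.range N, Real.cos (q * x) =
      Real.sin (N * x - x / 2) + Real.sin (x / 2) := by
  induction N with
  | zero => simp [Real.sin_neg]
  | succ N ih =>
    rw [Finset.sum_range_succ, mul_add, ih]
    have e : ((N + 1 : ℕ) : ℝ) * x - x / 2 = N * x + x / 2 := by push_cast; ring
    rw [e, Real.sin_add, Real.sin_sub]
    ring

theorem sum_cos_eq (J : ℕ) (m : ℤ) (hm : m ≠ 0) (hmJ : |m| < 2 * J) :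
    2 * ∑ q ∈ Finset.range J, Real.cos (q * (Real.pi * m / J)) = 1 - Real.cos (Real.pi * m) := by
  have hJ : (0 : ℝ) < J := by
    have := abs_nonneg m
    have : (0 : ℤ) < J := by omega
    exact_mod_cast this
  -- A zero would make `m` a nonzero multiple of `2 J`, contrary to `|m| < 2 J`.
  have hs : Real.sin (Real.pi * m / J / 2) ≠ 0 := by
    intro h
    rw [Real.sin_eq_zero_iff] at h
    obtain ⟨n, hn⟩ := h
    have hpi := Real.pi_pos.ne'
    have h2 : (m : ℝ) = n * (2 * J) := by
      field_simp at hn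
      linarith
    have h3 : m = n * (2 * J) := by exact_mod_cast h2
    have hn0 : n ≠ 0 := by rintro rfl; simp at h3; exact hm h3
    have h4 : 1 ≤ |n| := Int.one_le_abs hn0
    rw [h3, abs_mul, abs_of_nonneg (by positivity : (0 : ℤ) ≤ 2 * J)] at hmJ
    nlinarith [(by positivity : (0 : ℤ) ≤ 2 * J)]
  have h := two_mul_sin_mul_sum_cos (Real.pi * m / J) J
  have e : (J : ℝ) * (Real.pi * m / J) = m * Real.pi := by field_simp
  rw [e, Real.sin_sub, Real.sin_int_mul_pi] at h
  refine mul_left_cancel₀ hs ?_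
  rw [show Real.cos (Real.pi * m) = Real.cos (m * Real.pi) by rw [mul_comm]]
  linear_combination h

theorem sum_natCast_Ico {M : Type*} [AddCommMonoid M] (J : ℕ) (f : ℤ → M) :
    ∑ n ∈ Finset.Ico 1 J, f n = ∑ r ∈ Finset.Ico (1 : ℤ) J, f r := by
  refine Finset.sum_bij (fun n _ => (n : ℤ)) ?_ ?_ ?_ fun _ _ => rfl
  · intro n hn; rw [Finset.mem_Ico] at hn ⊢; omega
  · intro a _ b _ h; exact Int.ofNat_inj.1 h
  · intro r hr
    rw [Finset.mem_Ico] at hr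
    exact ⟨r.toNat, by rw [Finset.mem_Ico]; omega, by omega⟩

/-- Discrete orthogonality of the sines. -/
theorem sum_sin_mul_sin (J : ℕ) {i j : ℤ} (hi : i ∈ Finset.Ico (1 : ℤ) J)
    (hj : j ∈ Finset.Ico (1 : ℤ) J) :
    (2 / J : ℝ) * ∑ q ∈ Finset.Ico (1 : ℤ) J,
      Real.sin (Real.pi * q * i / J) * Real.sin (Real.pi * q * j / J) = if i = j then 1 else 0 := by
  rw [Finset.mem_Ico] at hi hj
  have hJ : (0 : ℝ) < J := by
    have : (0 : ℤ) < J := by omega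
    exact_mod_cast this
  -- The terms with `q = 0` cancel in the difference of cosine sums, so the sums may start at zero.
  have e : 2 * ∑ q ∈ Finset.Ico (1 : ℤ) J,
      Real.sin (Real.pi * q * i / J) * Real.sin (Real.pi * q * j / J) =
      ∑ q ∈ Finset.range J, Real.cos (q * (Real.pi * (i - j : ℤ) / J)) -
      ∑ q ∈ Finset.range J, Real.cos (q * (Real.pi * (i + j : ℤ) / J)) := by
    rw [← sum_natCast_Ico, ← Finset.sum_sub_distrib, Finset.range_eq_Ico,
      Finset.sum_eq_sum_Ico_succ_bot (a := 0) (by exact_mod_cast hJ), Finset.mul_sum]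
    simp only [Nat.cast_zero, zero_mul, sub_self, zero_add]
    refine Finset.sum_congr rfl fun q _ => ?_
    have ea : (q : ℝ) * (Real.pi * (i - j : ℤ) / J) =
        Real.pi * q * i / J - Real.pi * q * j / J := by push_cast; ring
    have eb : (q : ℝ) * (Real.pi * (i + j : ℤ) / J) =
        Real.pi * q * i / J + Real.pi * q * j / J := by push_cast; ring
    rw [ea, eb, Real.cos_sub, Real.cos_add, Int.cast_natCast]
    ring
  have e2 := sum_cos_eq J (i + j) (by omega) (by rw [abs_of_nonneg (by omega)]; omega)
  have e3 : Real.cos (Real.pi * (i + j : ℤ)) = Real.cos (Real.pi * (i - j : ℤ)) := by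
    have : Real.pi * (i + j : ℤ) = Real.pi * (i - j : ℤ) + j * (2 * Real.pi) := by push_cast; ring
    rw [this, Real.cos_add_int_mul_two_pi]
  rw [div_mul_eq_mul_div, e, div_eq_iff hJ.ne']
  split_ifs with h
  · subst h
    rw [e3] at e2
    simp only [sub_self, Int.cast_zero, mul_zero, Real.cos_zero] at e2
    simp only [sub_self, Int.cast_zero, mul_zero, zero_div, Real.cos_zero, Finset.sum_const,
      Finset.card_range, nsmul_eq_mul, mul_one, one_mul]
    linarith
  · have e1 := sum_cos_eq J (i - j) (by omega) (by rw [abs_lt]; omega)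
    rw [e3] at e2
    linarith

/-! ### Discrete sine transforms and sine series. -/

namespace Data

variable {d : ℕ} (D : Data d)

/-- The internal transverse multi-indices. -/
def box : Finset (Fin d → ℤ) := Fintype.piFinset fun k => Finset.Ico (1 : ℤ) (D.J k.succ)

variable {D}

theorem mem_box {q : Fin d → ℤ} : q ∈ D.box ↔ ∀ k, q k ∈ Finset.Ico (1 : ℤ) (D.J k.succ) :=
  Fintype.mem_piFinset

theorem update_mem_box {q : Fin d → ℤ} (hq : q ∈ D.box) (k : Fin d) {r : ℤ}
    (hr : r ∈ Finset.Ico (1 : ℤ) (D.J k.succ)) : Function.update q k r ∈ D.box := by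
  rw [mem_box] at hq ⊢
  intro l
  rcases eq_or_ne l k with rfl | h
  · simpa using hr
  · rw [Function.update_of_ne h]; exact hq l

theorem sineF_apply (k : Fin d) (P : TransFn d) (q : Fin d → ℤ) : D.sineF k P q =
    (2 / (D.J k.succ : ℂ)) * ∑ r ∈ Finset.Ico (1 : ℤ) (D.J k.succ),
      P (Function.update q k r) *
        (Real.sin (Real.pi * (q k : ℝ) * (r : ℝ) / (D.J k.succ : ℝ)) : ℂ) := by
  rw [← sum_natCast_Ico]; simp [sineF]

theorem sineFinv_apply (k : Fin d) (P : TransFn d) (j : Fin d → ℤ) : D.sineFinv k P j =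
    ∑ r ∈ Finset.Ico (1 : ℤ) (D.J k.succ),
      P (Function.update j k r) *
        (Real.sin (Real.pi * (r : ℝ) * (j k : ℝ) / (D.J k.succ : ℝ)) : ℂ) := by
  rw [← sum_natCast_Ico]; simp [sineFinv]

theorem sineFinv_sineF (k : Fin d) (P : TransFn d) {j : Fin d → ℤ}
    (hj : j k ∈ Finset.Ico (1 : ℤ) (D.J k.succ)) : D.sineFinv k (D.sineF k P) j = P j := by
  rw [sineFinv_apply]
  simp only [sineF_apply, Function.update_idem, Function.update_self, Finset.mul_sum,
    Finset.sum_mul]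
  rw [Finset.sum_comm]
  have : ∀ r ∈ Finset.Ico (1 : ℤ) (D.J k.succ), ∑ q ∈ Finset.Ico (1 : ℤ) (D.J k.succ),
      2 / (D.J k.succ : ℂ) * (P (Function.update j k r) *
        (Real.sin (Real.pi * (q : ℝ) * (r : ℝ) / (D.J k.succ : ℝ)) : ℂ)) *
        (Real.sin (Real.pi * (q : ℝ) * (j k : ℝ) / (D.J k.succ : ℝ)) : ℂ) =
      if r = j k then P (Function.update j k r) else 0 := by
    intro r hr
    have h := congrArg (fun t : ℝ => P (Function.update j k r) * (t : ℂ))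
      (sum_sin_mul_sin (D.J k.succ) hr hj)
    simp only [Complex.ofReal_mul, Complex.ofReal_sum, Finset.mul_sum] at h
    rw [show (if r = j k then P (Function.update j k r) else 0) =
      P (Function.update j k r) * ((if r = j k then 1 else 0 : ℝ) : ℂ) by split_ifs <;> simp, ← h]
    refine Finset.sum_congr rfl fun q _ => ?_
    push_cast; ring
  rw [Finset.sum_congr rfl this, Finset.sum_ite_eq' _ _, if_pos hj, Function.update_eq_self]

/-- The sine kernel is symmetric in the node and the frequency, so both orders of composition give
the same double sum. -/
theorem sineF_sineFinv (k : Fin d) (P : TransFn d) {j : Fin d → ℤ}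
    (hj : j k ∈ Finset.Ico (1 : ℤ) (D.J k.succ)) : D.sineF k (D.sineFinv k P) j = P j := by
  rw [← sineFinv_sineF k P hj, sineF_apply, sineFinv_apply, Finset.mul_sum]
  simp only [sineF_apply, sineFinv_apply, Function.update_idem, Function.update_self,
    Finset.mul_sum, Finset.sum_mul]
  refine Finset.sum_congr rfl fun r _ => Finset.sum_congr rfl fun q _ => ?_
  rw [mul_right_comm (Real.pi) (q : ℝ), mul_right_comm (Real.pi) (j k : ℝ)]
  ring

theorem sineF_congr (k : Fin d) {P P' : TransFn d} (h : ∀ q ∈ D.box, P q = P' q) :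
    ∀ q ∈ D.box, D.sineF k P q = D.sineF k P' q := by
  intro q hq
  rw [sineF_apply, sineF_apply]
  congr 1
  exact Finset.sum_congr rfl fun r hr => by rw [h _ (update_mem_box hq k hr)]

theorem foldl_sineF_congr (l : List (Fin d)) : ∀ {P P' : TransFn d}, (∀ q ∈ D.box, P q = P' q) →
    ∀ q ∈ D.box, l.foldl (fun Q k => D.sineF k Q) P q = l.foldl (fun Q k => D.sineF k Q) P' q := by
  induction l with
  | nil => intro P P' h; exact h
  | cons k l ih => intro P P' h; exact ih (sineF_congr k h)

theorem foldr_sineFinv_foldl_sineF (l : List (Fin d)) : ∀ (P : TransFn d), ∀ j ∈ D.box,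
    l.foldr (fun k Q => D.sineFinv k Q) (l.foldl (fun Q k => D.sineF k Q) P) j = P j := by
  induction l with
  | nil => intro P j _; rfl
  | cons k l ih =>
    intro P j hj
    rw [List.foldr_cons, List.foldl_cons, ← sineFinv_sineF k P (mem_box.1 hj k), sineFinv_apply,
      sineFinv_apply]
    exact Finset.sum_congr rfl fun r hr => by rw [ih _ _ (update_mem_box hj k hr)]

theorem foldl_sineF_foldr_sineFinv (l : List (Fin d)) : ∀ (P : TransFn d), ∀ j ∈ D.box,
    l.foldl (fun Q k => D.sineF k Q) (l.foldr (fun k Q => D.sineFinv k Q) P) j = P j := by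
  induction l with
  | nil => intro P j _; rfl
  | cons k l ih =>
    intro P j hj
    rw [List.foldr_cons, List.foldl_cons, ← ih P j hj]
    exact foldl_sineF_congr l (fun q hq => sineF_sineFinv k _ (mem_box.1 hq k)) j hj

theorem sineFinvAll_sineFAll (P : TransFn d) {j : Fin d → ℤ} (hj : j ∈ D.box) :
    D.sineFinvAll (D.sineFAll P) j = P j := foldr_sineFinv_foldl_sineF _ P j hj

theorem sineFAll_zero : D.sineFAll 0 = 0 := by
  unfold sineFAll
  induction List.finRange d with
  | nil => rfl
  | cons k l ih =>
    have : D.sineF k 0 = 0 := by funext q; simp [sineF]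
    rw [List.foldl_cons, this, ih]

/-- Uniqueness of sine coefficients: it lets an identity at all interior transverse nodes be read
mode by mode. -/
theorem eq_zero_of_sineFinvAll_eq_zero {P : TransFn d} (h : ∀ j ∈ D.box, D.sineFinvAll P j = 0)
    {q : Fin d → ℤ} (hq : q ∈ D.box) : P q = 0 := by
  have e : D.sineFAll (D.sineFinvAll P) q = P q := foldl_sineF_foldr_sineFinv _ P q hq
  have e0 : D.sineFAll (D.sineFinvAll P) q = D.sineFAll 0 q := foldl_sineF_congr _ h q hq
  rw [← e, e0, sineFAll_zero, Pi.zero_apply]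

open Filter Topology in
theorem tendsto_sineFAll {ι : Type*} {f : Filter ι} {P : ι → TransFn d}
    (h : ∀ q ∈ D.box, Tendsto (fun x => P x q) f (𝓝 0)) :
    ∀ q ∈ D.box, Tendsto (fun x => D.sineFAll (P x) q) f (𝓝 0) := by
  unfold sineFAll
  generalize List.finRange d = l
  induction l generalizing P with
  | nil => exact h
  | cons k l ih =>
    refine ih fun q hq => ?_
    simp only [sineF_apply]
    have : Tendsto (fun x => ∑ r ∈ Finset.Ico (1 : ℤ) (D.J k.succ), P x (Function.update q k r) *
        (Real.sin (Real.pi * (q k : ℝ) * (r : ℝ) / (D.J k.succ : ℝ)) : ℂ)) f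
        (𝓝 (∑ r ∈ Finset.Ico (1 : ℤ) (D.J k.succ), 0 *
        (Real.sin (Real.pi * (q k : ℝ) * (r : ℝ) / (D.J k.succ : ℝ)) : ℂ))) :=
      tendsto_finsetSum _ fun r hr => (h _ (update_mem_box hq k hr)).mul_const _
    simpa using this.const_mul (2 / (D.J k.succ : ℂ))

variable (D) in
/-- The product of the sines. -/
def sines (q j : Fin d → ℤ) : ℂ :=
  ∏ k : Fin d, (Real.sin (Real.pi * (q k : ℝ) * (j k : ℝ) / (D.J k.succ : ℝ)) : ℂ)

/-- For the induction, the directions outside `l` are not yet transformed and stay frozen at `j`,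
hence the singletons in the index set. -/
theorem foldr_sineFinv_eq_sum (P : TransFn d) (l : List (Fin d)) (hl : l.Nodup) :
    ∀ j : Fin d → ℤ, l.foldr (fun k Q => D.sineFinv k Q) P j =
      ∑ q ∈ Fintype.piFinset (fun k => if k ∈ l then Finset.Ico (1 : ℤ) (D.J k.succ) else {j k}),
        P q * ∏ k ∈ l.toFinset,
          (Real.sin (Real.pi * (q k : ℝ) * (j k : ℝ) / (D.J k.succ : ℝ)) : ℂ) := by
  induction l with
  | nil =>
    intro j
    have : Fintype.piFinset (fun k => ({j k} : Finset ℤ)) = {j} := by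
      ext q; simp [funext_iff]
    simp [this]
  | cons a l ih =>
    intro j
    rw [List.nodup_cons] at hl
    rw [List.foldr_cons, sineFinv_apply]
    rw [← Finset.sum_fiberwise_of_maps_to (g := fun q : Fin d → ℤ => q a)
      (t := Finset.Ico (1 : ℤ) (D.J a.succ))]
    · refine Finset.sum_congr rfl fun r hr => ?_
      rw [ih hl.2, Finset.sum_mul]
      refine Finset.sum_congr ?_ fun q hq => ?_
      · ext q
        simp only [Fintype.mem_piFinset, Finset.mem_filter]
        constructor
        · intro h
          have ha := h a
          rw [if_neg hl.1, Function.update_self, Finset.mem_singleton] at ha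
          refine ⟨fun k => ?_, ha⟩
          have hk := h k
          rcases eq_or_ne k a with rfl | hka
          · rw [if_pos (by simp), ha]; exact hr
          · rw [Function.update_of_ne hka] at hk
            simpa [hka] using hk
        · rintro ⟨h, ha⟩ k
          have hk := h k
          rcases eq_or_ne k a with rfl | hka
          · rw [if_neg hl.1, Function.update_self, Finset.mem_singleton]; exact ha
          · rw [Function.update_of_ne hka]
            simpa [hka] using hk
      · have ha := (Finset.mem_filter.1 (by assumption)).2
        rw [List.toFinset_cons, Finset.prod_insert (by simpa using hl.1), ha]
        rw [mul_assoc, mul_comm (∏ k ∈ l.toFinset, _)]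
        congr 2
        refine Finset.prod_congr rfl fun k hk => ?_
        have : k ≠ a := by rintro rfl; exact hl.1 (by simpa using hk)
        rw [Function.update_of_ne this]
    · intro q hq
      have := Fintype.mem_piFinset.1 hq a
      simpa using this

theorem sineFinvAll_apply (P : TransFn d) (j : Fin d → ℤ) :
    D.sineFinvAll P j = ∑ q ∈ D.box, P q * D.sines q j := by
  rw [sineFinvAll, foldr_sineFinv_eq_sum P _ (List.nodup_finRange d)]
  simp [box, sines]

theorem sines_eq_zero {q j : Fin d → ℤ} (k : Fin d) (h : j k = 0 ∨ j k = D.J k.succ)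
    (hJ : 1 ≤ D.J k.succ) : D.sines q j = 0 := by
  refine Finset.prod_eq_zero (Finset.mem_univ k) ?_
  rw [Complex.ofReal_eq_zero]
  rcases h with h | h
  · simp [h]
  · have : (D.J k.succ : ℝ) ≠ 0 := by positivity
    rw [h, Int.cast_natCast, mul_div_cancel_right₀ _ this, mul_comm, Real.sin_int_mul_pi]

/-! ### Pointwise formulas for the difference operators. -/

theorem shift_apply (k : Fin (d + 1)) (a : ℤ) (W : MeshFn d) (j : Fin (d + 1) → ℤ) :
    shift k a W j = W (j + Pi.single k a) := rfl

theorem sN_apply (k : Fin (d + 1)) (W : MeshFn d) (j : Fin (d + 1) → ℤ) :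
    sN k W j = 1 / 12 * W (j + Pi.single k (-1)) + 5 / 6 * W j + 1 / 12 * W (j + Pi.single k 1) := by
  simp [sN, shift_apply]

theorem bwd_apply (k : Fin (d + 1)) (W : MeshFn d) (j : Fin (d + 1) → ℤ) :
    D.bwd k W j = (D.step k : ℂ)⁻¹ * (W j - W (j + Pi.single k (-1))) := by
  simp [bwd, shift_apply]

theorem fwd_mul_bwd_apply (k : Fin (d + 1)) (W : MeshFn d) (j : Fin (d + 1) → ℤ) :
    (D.fwd k * D.bwd k) W j = (D.step k : ℂ)⁻¹ ^ 2 *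
      (W (j + Pi.single k (-1)) - 2 * W j + W (j + Pi.single k 1)) := by
  have : j + Pi.single k 1 + Pi.single k (-1) = j := by
    rw [add_assoc, ← Pi.single_add]; simp
  simp [fwd, bwd, shift_apply, this]
  ring

theorem sN1minus_apply (W : MeshFn d) (j : Fin (d + 1) → ℤ) :
    sN1minus W j = 5 / 12 * W j + 1 / 12 * W (j + Pi.single 0 (-1)) := by
  simp [sN1minus, shift_apply]

/-! ### Separation of variables -/

/-- The product of a function of `j₁` and a function of `(j₂, …, jₙ)`. -/
def tens (f : ℤ → ℂ) (e : TransFn d) : MeshFn d := fun j => f (j 0) * e (Fin.tail j)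

theorem tens_apply (f : ℤ → ℂ) (e : TransFn d) (j : Fin (d + 1) → ℤ) :
    tens f e j = f (j 0) * e (Fin.tail j) := rfl

theorem tens_add_single_zero (f : ℤ → ℂ) (e : TransFn d) (j : Fin (d + 1) → ℤ) (a : ℤ) :
    tens f e (j + Pi.single 0 a) = f (j 0 + a) * e (Fin.tail j) := by
  have : Fin.tail (j + Pi.single 0 a) = Fin.tail j := by
    funext k; simp [Fin.tail]
  rw [tens_apply, this]; simp

theorem tens_add_single_succ (f : ℤ → ℂ) (e : TransFn d) (j : Fin (d + 1) → ℤ) (k : Fin d) (a : ℤ) :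
    tens f e (j + Pi.single k.succ a) = f (j 0) * e (Fin.tail j + Pi.single k a) := by
  have : Fin.tail (j + Pi.single k.succ a) = Fin.tail j + Pi.single k a := by
    funext l
    simp only [Fin.tail, Pi.add_apply]
    rcases eq_or_ne l k with rfl | h
    · simp
    · rw [Pi.single_eq_of_ne h, Pi.single_eq_of_ne (by simpa using h)]
  rw [tens_apply, this]; simp [(Fin.succ_ne_zero k).symm]

theorem sN_zero_tens (f : ℤ → ℂ) (e : TransFn d) :
    sN 0 (tens f e) = tens (fun x => 1 / 12 * f (x - 1) + 5 / 6 * f x + 1 / 12 * f (x + 1)) e := by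
  funext j
  rw [sN_apply, tens_add_single_zero, tens_add_single_zero, tens_apply, tens_apply,
    ← sub_eq_add_neg]
  ring

theorem fwd_mul_bwd_zero_tens (f : ℤ → ℂ) (e : TransFn d) :
    (D.fwd 0 * D.bwd 0) (tens f e) =
      tens (fun x => (D.step 0 : ℂ)⁻¹ ^ 2 * (f (x - 1) - 2 * f x + f (x + 1))) e := by
  funext j
  rw [fwd_mul_bwd_apply, tens_add_single_zero, tens_add_single_zero, tens_apply, tens_apply,
    ← sub_eq_add_neg]
  ring

/-- Only the factor in direction `k` moves, and `sin (θ - φ) + sin (θ + φ) = 2 cos φ sin θ`. Both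
eigenvalues `σ` and `-λ` come from this identity. -/
theorem sines_add_single (q j : Fin d → ℤ) (k : Fin d) :
    D.sines q (j + Pi.single k (-1)) + D.sines q (j + Pi.single k 1) =
      2 * (Real.cos (Real.pi * q k / D.J k.succ) : ℂ) * D.sines q j := by
  have e : ∀ a : ℤ, D.sines q (j + Pi.single k a) =
      (Real.sin (Real.pi * (q k : ℝ) * ((j k + a : ℤ) : ℝ) / (D.J k.succ : ℝ)) : ℂ) *
      ∏ l ∈ Finset.univ.erase k,
        (Real.sin (Real.pi * (q l : ℝ) * (j l : ℝ) / (D.J l.succ : ℝ)) : ℂ) := by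
    intro a
    rw [sines, ← Finset.mul_prod_erase _ _ (Finset.mem_univ k)]
    congr 1
    · simp
    · refine Finset.prod_congr rfl fun l hl => ?_
      rw [Pi.add_apply, Pi.single_eq_of_ne (Finset.ne_of_mem_erase hl), add_zero]
  have e0 := e 0
  rw [Pi.single_zero, add_zero] at e0
  rw [e, e, e0, ← add_mul, ← mul_assoc]
  congr 1
  rw [← Complex.ofReal_add, ← Complex.ofReal_ofNat, ← Complex.ofReal_mul, ← Complex.ofReal_mul]
  congr 1
  have e1 : Real.pi * (q k : ℝ) * ((j k + -1 : ℤ) : ℝ) / (D.J k.succ : ℝ) =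
      Real.pi * q k * (j k + 0 : ℤ) / D.J k.succ - Real.pi * q k / D.J k.succ := by
    push_cast; ring
  have e2 : Real.pi * (q k : ℝ) * ((j k + 1 : ℤ) : ℝ) / (D.J k.succ : ℝ) =
      Real.pi * q k * (j k + 0 : ℤ) / D.J k.succ + Real.pi * q k / D.J k.succ := by
    push_cast; ring
  rw [e1, e2, Real.sin_sub, Real.sin_add]
  ring

theorem Admissible.cos_eq (hD : D.Admissible) (k : Fin (d + 1)) (q : ℤ) :
    Real.cos (Real.pi * q / D.J k) =
      1 - 2 * Real.sin (Real.pi * (q : ℝ) * D.step k / (2 * D.X k)) ^ 2 := by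
  have hX := (hD.X_pos k).ne'
  have hJ : (D.J k : ℝ) ≠ 0 := by
    have := hD.J_pos k
    positivity
  have e : Real.pi * q / D.J k = 2 * (Real.pi * (q : ℝ) * D.step k / (2 * D.X k)) := by
    rw [step]; field_simp
  rw [e, Real.cos_two_mul, Real.cos_sq']
  ring

theorem Admissible.sN_succ_tens (hD : D.Admissible) (f : ℤ → ℂ) (q : Fin d → ℤ) (k : Fin d) :
    sN k.succ (tens f (D.sines q)) = (D.sig k.succ (q k) : ℂ) • tens f (D.sines q) := by
  funext j
  rw [sN_apply, tens_add_single_succ, tens_add_single_succ, Pi.smul_apply, tens_apply, smul_eq_mul]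
  have h := sines_add_single (D := D) q (Fin.tail j) k
  rw [hD.cos_eq] at h
  simp only [sig]
  push_cast at h ⊢
  linear_combination (1 / 12 * f (j 0)) * h

theorem Admissible.fwd_mul_bwd_succ_tens (hD : D.Admissible) (f : ℤ → ℂ) (q : Fin d → ℤ)
    (k : Fin d) : (D.fwd k.succ * D.bwd k.succ) (tens f (D.sines q)) =
      -(D.lam k.succ (q k) : ℂ) • tens f (D.sines q) := by
  funext j
  rw [fwd_mul_bwd_apply, tens_add_single_succ, tens_add_single_succ, Pi.smul_apply, tens_apply,
    smul_eq_mul]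
  have h := sines_add_single (D := D) q (Fin.tail j) k
  rw [hD.cos_eq] at h
  simp only [lam]
  push_cast at h ⊢
  linear_combination ((D.step k.succ : ℂ)⁻¹ ^ 2 * f (j 0)) * h

variable (D) in
/-- The eigenvalue of the product of all transverse Numerov averages. -/
def sigProd (q : Fin d → ℤ) : ℂ := ∏ k : Fin d, (D.sig k.succ (q k) : ℂ)

theorem sig_ne_zero (k : Fin (d + 1)) (q : ℤ) : (D.sig k q : ℂ) ≠ 0 := by
  have h := Real.sin_sq_le_one (Real.pi * (q : ℝ) * D.step k / (2 * D.X k))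
  have : 0 < D.sig k q := by unfold sig; linarith
  exact_mod_cast this.ne'

theorem sigProd_ne_zero (q : Fin d → ℤ) : D.sigProd q ≠ 0 :=
  Finset.prod_ne_zero_iff.2 fun _ _ => sig_ne_zero _ _

theorem Admissible.prod_map_sN_tens (hD : D.Admissible) (f : ℤ → ℂ) (q : Fin d → ℤ)
    (l : List (Fin d)) : ((l.map fun k => sN k.succ).prod) (tens f (D.sines q)) =
      ((l.map fun k => (D.sig k.succ (q k) : ℂ)).prod) • tens f (D.sines q) := by
  induction l with
  | nil => simp
  | cons k l ih =>
    rw [List.map_cons, List.map_cons, List.prod_cons, List.prod_cons, Module.End.mul_apply, ih,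
      map_smul, hD.sN_succ_tens, smul_smul, mul_comm]

/-- The direction `x₁` comes first in the list, so its factor splits off on the left without any
commutation of operators. -/
theorem sNprod_eq (p : Fin (d + 1) → Prop) [DecidablePred p] : sNprod p =
    (if p 0 then sN 0 else 1) *
      (((List.finRange d).filter fun k => p k.succ).map fun k => sN k.succ).prod := by
  rw [sNprod, List.finRange_succ, List.filter_cons, List.filter_map]
  split_ifs with h1 h2 h2 <;> simp_all [Function.comp_def]

theorem sBar_eq : (sBar : Module.End ℂ (MeshFn d)) = sN 0 * sBarHat 0 := by
  rw [sBar, sBarHat, sNprod_eq, sNprod_eq]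
  simp

theorem sBarHat_succ_eq (k : Fin d) :
    (sBarHat k.succ : Module.End ℂ (MeshFn d)) = sN 0 * sBarHat1 k.succ := by
  rw [sBarHat, sBarHat1, sNprod_eq, sNprod_eq]
  simp [(Fin.succ_ne_zero k).symm]

theorem lapN_eq : D.lapN = sBarHat 0 * (D.fwd 0 * D.bwd 0) + sN 0 * D.lapNTrans := by
  rw [lapN, Fin.sum_univ_succ, lapNTrans, Finset.mul_sum]
  simp only [sBarHat_succ_eq, mul_assoc]

theorem Admissible.sBarHat_zero_tens (hD : D.Admissible) (f : ℤ → ℂ) (q : Fin d → ℤ) :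
    sBarHat 0 (tens f (D.sines q)) = D.sigProd q • tens f (D.sines q) := by
  rw [sBarHat, sNprod_eq]
  simp only [ne_eq, not_true_eq_false, if_false, one_mul, Fin.succ_ne_zero, not_false_eq_true,
    decide_true, List.filter_true]
  rw [hD.prod_map_sN_tens, sigProd]
  rw [Fin.prod_univ_def]

theorem Admissible.sBarHat1_succ_tens (hD : D.Admissible) (f : ℤ → ℂ) (q : Fin d → ℤ) (k : Fin d) :
    sBarHat1 k.succ (tens f (D.sines q)) =
      (D.sigProd q / D.sig k.succ (q k)) • tens f (D.sines q) := by
  rw [sBarHat1, sNprod_eq]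
  simp only [ne_eq, not_true_eq_false, false_and, if_false, one_mul, Fin.succ_ne_zero,
    not_false_eq_true, true_and, Fin.succ_inj]
  rw [hD.prod_map_sN_tens, sigProd]
  congr 1
  rw [eq_div_iff (sig_ne_zero _ _), ← List.prod_toFinset _ ((List.nodup_finRange d).filter _),
    ← Finset.prod_erase_mul _ _ (Finset.mem_univ k)]
  congr 2
  ext l
  simp

variable (D) in
/-- The sum of the eigenvalues of the transverse operators. -/
def lamSum (q : Fin d → ℤ) : ℂ := ∑ k : Fin d, (D.lam k.succ (q k) : ℂ) / D.sig k.succ (q k)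

theorem Vq_eq (q : Fin d → ℤ) : (D.Vq q : ℂ) = D.Vinf + D.ch * D.lamSum q := by
  simp [Vq, lamSum]

theorem Admissible.lapNTrans_tens (hD : D.Admissible) (f : ℤ → ℂ) (q : Fin d → ℤ) :
    D.lapNTrans (tens f (D.sines q)) = -(D.sigProd q * D.lamSum q) • tens f (D.sines q) := by
  rw [lapNTrans, LinearMap.sum_apply, lamSum, Finset.mul_sum, ← Finset.sum_neg_distrib,
    Finset.sum_smul]
  refine Finset.sum_congr rfl fun k _ => ?_
  rw [Module.End.mul_apply, hD.fwd_mul_bwd_succ_tens, map_smul, hD.sBarHat1_succ_tens, smul_smul]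
  congr 1
  ring

theorem Admissible.sBar_tens (hD : D.Admissible) (f : ℤ → ℂ) (q : Fin d → ℤ)
    (j : Fin (d + 1) → ℤ) : sBar (tens f (D.sines q)) j = D.sigProd q *
      (1 / 12 * f (j 0 - 1) + 5 / 6 * f (j 0) + 1 / 12 * f (j 0 + 1)) * D.sines q (Fin.tail j) := by
  rw [sBar_eq, Module.End.mul_apply, hD.sBarHat_zero_tens, map_smul, sN_zero_tens, Pi.smul_apply,
    tens_apply, smul_eq_mul, mul_assoc]

theorem Admissible.lapN_tens (hD : D.Admissible) (f : ℤ → ℂ) (q : Fin d → ℤ)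
    (j : Fin (d + 1) → ℤ) : D.lapN (tens f (D.sines q)) j = D.sigProd q *
      ((D.step 0 : ℂ)⁻¹ ^ 2 * (f (j 0 - 1) - 2 * f (j 0) + f (j 0 + 1)) - D.lamSum q *
        (1 / 12 * f (j 0 - 1) + 5 / 6 * f (j 0) + 1 / 12 * f (j 0 + 1))) *
      D.sines q (Fin.tail j) := by
  rw [lapN_eq, LinearMap.add_apply, Pi.add_apply, Module.End.mul_apply (sBarHat 0),
    Module.End.mul_apply (sN 0), fwd_mul_bwd_zero_tens, hD.sBarHat_zero_tens, hD.lapNTrans_tens, map_smul, sN_zero_tens,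
    Pi.smul_apply, Pi.smul_apply, tens_apply, tens_apply, smul_eq_mul, smul_eq_mul]
  ring

theorem Admissible.sBarHat_bwd_tens (hD : D.Admissible) (f : ℤ → ℂ) (q : Fin d → ℤ)
    (j : Fin (d + 1) → ℤ) : sBarHat 0 (D.bwd 0 (tens f (D.sines q))) j = D.sigProd q *
      ((D.step 0 : ℂ)⁻¹ * (f (j 0) - f (j 0 - 1))) * D.sines q (Fin.tail j) := by
  have : D.bwd 0 (tens f (D.sines q)) =
      tens (fun x => (D.step 0 : ℂ)⁻¹ * (f x - f (x - 1))) (D.sines q) := by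
    funext j
    rw [bwd_apply, tens_add_single_zero, tens_apply, tens_apply, ← sub_eq_add_neg]
    ring
  rw [this, hD.sBarHat_zero_tens, Pi.smul_apply, tens_apply, smul_eq_mul, ← mul_assoc]

theorem Admissible.sN1minus_sBarHat_tens (hD : D.Admissible) (f : ℤ → ℂ) (q : Fin d → ℤ)
    (j : Fin (d + 1) → ℤ) : sN1minus (sBarHat 0 (tens f (D.sines q))) j = D.sigProd q *
      (5 / 12 * f (j 0) + 1 / 12 * f (j 0 - 1)) * D.sines q (Fin.tail j) := by
  rw [hD.sBarHat_zero_tens, map_smul, Pi.smul_apply, sN1minus_apply, tens_add_single_zero,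
    tens_apply, ← sub_eq_add_neg, smul_eq_mul]
  ring

theorem Admissible.sN1minus_lapNTrans_tens (hD : D.Admissible) (f : ℤ → ℂ) (q : Fin d → ℤ)
    (j : Fin (d + 1) → ℤ) : sN1minus (D.lapNTrans (tens f (D.sines q))) j =
      -(D.sigProd q * D.lamSum q) *
      (5 / 12 * f (j 0) + 1 / 12 * f (j 0 - 1)) * D.sines q (Fin.tail j) := by
  rw [hD.lapNTrans_tens, map_smul, Pi.smul_apply, sN1minus_apply, tens_add_single_zero,
    tens_apply, ← sub_eq_add_neg, smul_eq_mul]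
  ring

/-! ### Locality -/

/-- `A W` at a node depends only on the values of `W` at the nodes that are at most one step away
in the directions from `p` and coincide with it in the others. -/
def IsLocal (p : Fin (d + 1) → Prop) (A : Module.End ℂ (MeshFn d)) : Prop :=
  ∀ (W : MeshFn d) (j : Fin (d + 1) → ℤ),
    (∀ i : Fin (d + 1) → ℤ, (∀ k, i k = j k ∨ (p k ∧ |i k - j k| ≤ 1)) → W i = 0) → A W j = 0

namespace IsLocal

variable {p p' : Fin (d + 1) → Prop} {A A' : Module.End ℂ (MeshFn d)}

theorem mono (h : IsLocal p A) (hp : ∀ k, p k → p' k) : IsLocal p' A :=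
  fun W j hW => h W j fun i hi => hW i fun k => (hi k).imp id fun h => ⟨hp k h.1, h.2⟩

theorem one : IsLocal p (1 : Module.End ℂ (MeshFn d)) :=
  fun _ j hW => hW j fun _ => Or.inl rfl

theorem add (h : IsLocal p A) (h' : IsLocal p A') : IsLocal p (A + A') := fun W j hW => by
  rw [LinearMap.add_apply, Pi.add_apply, h W j hW, h' W j hW, add_zero]

theorem sub (h : IsLocal p A) (h' : IsLocal p A') : IsLocal p (A - A') := fun W j hW => by
  rw [LinearMap.sub_apply, Pi.sub_apply, h W j hW, h' W j hW, sub_zero]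

theorem smul (c : ℂ) (h : IsLocal p A) : IsLocal p (c • A) := fun W j hW => by
  rw [LinearMap.smul_apply, Pi.smul_apply, h W j hW, smul_zero]

theorem sum {ι : Type*} {s : Finset ι} {A : ι → Module.End ℂ (MeshFn d)}
    (h : ∀ x ∈ s, IsLocal p (A x)) : IsLocal p (∑ x ∈ s, A x) := fun W j hW => by
  rw [LinearMap.sum_apply, Finset.sum_apply]
  exact Finset.sum_eq_zero fun x hx => h x hx W j hW

/-- With disjoint sets of directions each coordinate is moved by at most one of the factors, so the
stencil stays within one step. -/
theorem mul (h : IsLocal p A) (h' : IsLocal p' A') (hd : ∀ k, p k → ¬p' k) :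
    IsLocal (fun k => p k ∨ p' k) (A * A') := fun W j hW => by
  rw [Module.End.mul_apply]
  refine h _ j fun i hi => h' W i fun r hr => hW r fun k => ?_
  rcases hi k with e | ⟨hpk, hik⟩
  · rcases hr k with e' | ⟨hpk', hrk⟩
    · exact Or.inl (e'.trans e)
    · exact Or.inr ⟨Or.inr hpk', by rw [← e]; exact hrk⟩
  · rcases hr k with e' | ⟨hpk', _⟩
    · exact Or.inr ⟨Or.inl hpk, by rw [e']; exact hik⟩
    · exact absurd hpk' (hd k hpk)

theorem shift {k : Fin (d + 1)} (a : ℤ) (ha : |a| ≤ 1) : IsLocal (· = k) (Data.shift k a) :=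
  fun W j hW => by
    rw [shift_apply]
    refine hW _ fun l => ?_
    rcases eq_or_ne l k with rfl | h
    · right; simpa using ha
    · left; simp [h]

theorem sN (k : Fin (d + 1)) : IsLocal (· = k) (Data.sN k) :=
  (((shift (-1) (by simp)).smul _).add (one.smul _)).add ((shift 1 (by simp)).smul _)

theorem sN1minus : IsLocal (· = (0 : Fin (d + 1))) Data.sN1minus :=
  (one.smul _).add ((shift (-1) (by simp)).smul _)

theorem bwd (k : Fin (d + 1)) : IsLocal (· = k) (D.bwd k) :=
  (one.sub (shift (-1) (by simp))).smul _

/-- Both factors act in the same direction, so `mul` does not apply; the explicit three-point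
formula shows that the width is still one. -/
theorem fwd_mul_bwd (k : Fin (d + 1)) : IsLocal (· = k) (D.fwd k * D.bwd k) := fun W j hW => by
  have key : ∀ a : ℤ, |a| ≤ 1 → W (j + Pi.single k a) = 0 := fun a ha =>
    shift a ha W j hW
  have h0 := key 0 (by simp)
  rw [Pi.single_zero, add_zero] at h0
  rw [fwd_mul_bwd_apply, key (-1) (by simp), key 1 (by simp), h0]
  simp

theorem prod_map_sN (l : List (Fin (d + 1))) (hl : l.Nodup) :
    IsLocal (· ∈ l) ((l.map Data.sN).prod) := by
  induction l with
  | nil => exact one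
  | cons k l ih =>
    rw [List.nodup_cons] at hl
    rw [List.map_cons, List.prod_cons]
    refine ((IsLocal.sN k).mul (ih hl.2) ?_).mono ?_
    · rintro _ rfl; exact hl.1
    · intro r hr; simpa using hr

theorem sNprod (p : Fin (d + 1) → Prop) [DecidablePred p] : IsLocal p (Data.sNprod p) :=
  (prod_map_sN _ ((List.nodup_finRange _).filter _)).mono fun k hk => by simpa using hk

theorem lapN : IsLocal (fun _ => True) D.lapN :=
  sum fun k _ => ((sNprod _).mul (fwd_mul_bwd k) fun _ h => h).mono fun _ _ => trivial

theorem sBarHat_bwd : IsLocal (fun _ => True) (sBarHat 0 * D.bwd 0) :=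
  ((sNprod _).mul (bwd 0) fun _ h => h).mono fun _ _ => trivial

theorem sN1minus_sBarHat : IsLocal (fun _ => True)
    (Data.sN1minus * sBarHat 0 : Module.End ℂ (MeshFn d)) :=
  (sN1minus.mul (sNprod _) fun _ h h' => h' h).mono fun _ _ => trivial

theorem lapNTrans : IsLocal (· ≠ 0) D.lapNTrans :=
  sum fun k _ => ((sNprod _).mul (fwd_mul_bwd k.succ) fun _ h => h.2).mono fun l h => by
    rcases h with h | h
    · exact h.1
    · rw [h]; exact Fin.succ_ne_zero k

theorem sN1minus_lapNTrans : IsLocal (fun _ => True) (Data.sN1minus * D.lapNTrans) :=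
  (sN1minus.mul lapNTrans fun _ h h' => h' h).mono fun _ _ => trivial

/-- Used to replace the unknowns by their sine series, with which they need to agree only near the
node considered. -/
theorem congr (h : IsLocal (fun _ => True) A) {W W' : MeshFn d} {j : Fin (d + 1) → ℤ}
    (hW : ∀ i : Fin (d + 1) → ℤ, (∀ k, |i k - j k| ≤ 1) → W i = W' i) : A W j = A W' j := by
  rw [← sub_eq_zero, ← Pi.sub_apply, ← map_sub]
  refine h _ j fun i hi => ?_
  rw [Pi.sub_apply, sub_eq_zero]
  refine hW i fun k => ?_
  rcases hi k with e | e
  · simp [e]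
  · exact e.2

end IsLocal

/-! ### Nodes near and beyond the artificial boundary; decay and sine series of mesh functions. -/

theorem Admissible.node_ge (hD : D.Admissible) {j : Fin (d + 1) → ℤ} (hj : (D.J 0 : ℤ) - 2 ≤ j 0) :
    D.X0 ≤ D.node j 0 := by
  have h1 := hD.two_steps
  have h2 := hD.step_pos 0
  have hJ : (0 : ℝ) < D.J 0 := by exact_mod_cast hD.J_pos 0
  have e : D.X 0 = D.J 0 * D.step 0 := by rw [step]; field_simp
  have h3 : (D.J 0 : ℝ) - 2 ≤ j 0 := by exact_mod_cast hj
  have := mul_le_mul_of_nonneg_right h3 h2.le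
  rw [node]
  linarith

theorem Admissible.three_le (hD : D.Admissible) : 3 ≤ D.J 0 := by
  have h1 := hD.two_steps
  have h0 := hD.X0_pos
  have h2 := hD.step_pos 0
  have hJ : (0 : ℝ) < D.J 0 := by exact_mod_cast hD.J_pos 0
  have e : D.X 0 = D.J 0 * D.step 0 := by rw [step]; field_simp
  have : (2 : ℝ) < D.J 0 := by
    refine lt_of_mul_lt_mul_right ?_ h2.le
    linarith
  exact_mod_cast this

theorem Admissible.deltaV_eq_zero (hD : D.Admissible) {j : Fin (d + 1) → ℤ} (hj : j ∈ D.intInf)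
    (hj0 : (D.J 0 : ℤ) - 2 ≤ j 0) : D.deltaV j = 0 := by
  have h := hD.node_ge hj0
  rw [deltaV, hD.Vt_const _ h, hD.V_const _ h, sub_self]
  intro k
  have hs := hD.step_pos k.succ
  have hJ : (0 : ℝ) < D.J k.succ := by exact_mod_cast hD.J_pos k.succ
  have e : D.X k.succ = D.J k.succ * D.step k.succ := by rw [step]; field_simp
  obtain ⟨h1, h2⟩ := hj.2 k
  have h1' : (0 : ℝ) < j k.succ := by exact_mod_cast (by omega : 0 < j k.succ)
  have h2' : (j k.succ : ℝ) < D.J k.succ := by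
    exact_mod_cast (by omega : j k.succ < (D.J k.succ : ℤ))
  rw [node, e]
  exact ⟨by positivity, mul_lt_mul_of_pos_right h2' hs⟩

theorem Admissible.eq_of_halfStep (hD : D.Admissible) {U W : MeshFn d} {j : Fin (d + 1) → ℤ}
    (hj : j ∈ D.intInf) (hj0 : (D.J 0 : ℤ) - 2 ≤ j 0) (h : D.HalfStep U W j) : W j = U j := by
  have hτ : (D.tau : ℂ) ≠ 0 := by exact_mod_cast hD.tau_pos.ne'
  have hb : (D.hbar : ℂ) ≠ 0 := by exact_mod_cast hD.hbar_pos.ne'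
  rw [HalfStep, hD.deltaV_eq_zero hj hj0, Complex.ofReal_zero, zero_mul] at h
  simpa [hτ, hb, sub_eq_zero] using h

theorem bdryFin_subset_bdryInf : D.bdryFin ⊆ D.bdryInf := by
  rintro j ⟨⟨⟨hj, hj0⟩, h1⟩, h2⟩
  refine ⟨hj, fun h => ?_⟩
  rcases lt_or_eq_of_le hj0 with h0 | h0
  · exact h1 ⟨h, by omega⟩
  · exact h2 ⟨h, h0⟩

theorem tail_mem_box {j : Fin (d + 1) → ℤ} (hj : j ∈ D.intInf) : Fin.tail j ∈ D.box :=
  mem_box.2 fun k => Finset.mem_Ico.2 (by have := hj.2 k; simp only [Fin.tail]; omega)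

theorem mem_intInf_cons {x : ℤ} {i : Fin d → ℤ} (hx : 1 ≤ x) (hi : i ∈ D.box) :
    (Fin.cons x i : Fin (d + 1) → ℤ) ∈ D.intInf := by
  refine ⟨by simpa using hx, fun k => ?_⟩
  have := Finset.mem_Ico.1 (mem_box.1 hi k)
  rw [Fin.cons_succ]
  omega

theorem mem_meshInf_of_near {i j : Fin (d + 1) → ℤ} (hj : j ∈ D.intInf)
    (h : ∀ k, |i k - j k| ≤ 1) : i ∈ D.meshInf := by
  refine ⟨?_, fun k => ?_⟩
  · have := abs_le.1 (h 0); have := hj.1; omega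
  · have := abs_le.1 (h k.succ); have := hj.2 k; omega

-- The terms of a summable family tend to zero along the cofinite filter, and an injective sequence
-- of nodes pulls this back to `atTop`.
open Filter Topology in
theorem MemHh.tendsto {W : MeshFn d} (hW : D.MemHh W) {i : Fin d → ℤ} (hi : i ∈ D.box)
    {x : ℕ → ℤ} (hx : ∀ n, 1 ≤ x n) (hinj : Function.Injective x) :
    Tendsto (fun n => W (Fin.cons (x n) i)) atTop (𝓝 0) := by
  have h1 := hW.2.tendsto_cofinite_zero
  let φ : ℕ → D.intInf := fun n => ⟨Fin.cons (x n) i, mem_intInf_cons (hx n) hi⟩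
  have hφ : Function.Injective φ := fun a b h =>
    hinj (by simpa [φ] using congrFun (congrArg Subtype.val h) 0)
  have h2 := h1.comp hφ.tendsto_cofinite
  rw [Nat.cofinite_eq_atTop] at h2
  have h3 : Tendsto (fun n => ‖W (Fin.cons (x n) i)‖ ^ 2) atTop (𝓝 0) := h2
  have h4 := h3.sqrt
  simp only [Real.sqrt_sq (norm_nonneg _), Real.sqrt_zero] at h4
  exact tendsto_zero_iff_norm_tendsto_zero.2 h4

variable (D) in
/-- The transverse Fourier coefficients of a mesh function. -/
def coef (W : MeshFn d) (q : Fin d → ℤ) (x : ℤ) : ℂ := D.sineFAll (fun i => W (Fin.cons x i)) q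

variable (D) in
/-- The sine series of a mesh function. -/
def series (W : MeshFn d) : MeshFn d := ∑ q ∈ D.box, tens (D.coef W q) (D.sines q)

theorem Admissible.series_eq (hD : D.Admissible) {W : MeshFn d} (hW : ∀ j ∈ D.bdryInf, W j = 0)
    {j : Fin (d + 1) → ℤ} (hj : j ∈ D.meshInf) (hj0 : 1 ≤ j 0) : W j = D.series W j := by
  have e : D.series W j = ∑ q ∈ D.box, D.coef W q (j 0) * D.sines q (Fin.tail j) := by
    rw [series, Finset.sum_apply]; rfl
  rw [e]
  by_cases h : j ∈ D.intInf
  · have h1 := sineFinvAll_sineFAll (fun i => W (Fin.cons (j 0) i)) (tail_mem_box h)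
    rw [sineFinvAll_apply, Fin.cons_self_tail] at h1
    exact h1.symm
  · rw [hW j ⟨hj, h⟩]
    -- As `j 0 ≥ 1`, a boundary node lies on a lateral face, where every product of sines vanishes.
    have : ∃ k : Fin d, Fin.tail j k = 0 ∨ Fin.tail j k = D.J k.succ := by
      by_contra hcon
      push Not at hcon
      refine h ⟨hj0, fun k => ?_⟩
      have h1 := hcon k
      have h2 := hj.2 k
      simp only [Fin.tail] at h1
      omega
    obtain ⟨k, hk⟩ := this
    refine (Finset.sum_eq_zero fun q _ => ?_).symm
    rw [sines_eq_zero k hk (hD.J_pos _), mul_zero]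

theorem map_series {A : Module.End ℂ (MeshFn d)} {ev : (ℤ → ℂ) → (Fin d → ℤ) → ℤ → ℂ}
    (hA : ∀ f q j, A (tens f (D.sines q)) j = ev f q (j 0) * D.sines q (Fin.tail j))
    (W : MeshFn d) (j : Fin (d + 1) → ℤ) :
    A (D.series W) j = ∑ q ∈ D.box, ev (D.coef W q) q (j 0) * D.sines q (Fin.tail j) := by
  rw [series, map_sum, Finset.sum_apply]
  exact Finset.sum_congr rfl fun q _ => hA _ _ _

/-! ### From the solution on the infinite mesh to the transparent boundary condition. -/

section Solution

variable {F : ℕ → MeshFn d} {Psi0 : MeshFn d} {B T Psi : ℕ → MeshFn d}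

/-- The sequence `T¹, T², …` with zero initial term. -/
def extendZero (T : ℕ → MeshFn d) (m : ℕ) : MeshFn d := if m = 0 then 0 else T m

theorem SolvesInf.extendZero_bdry (hsol : D.SolvesInf F Psi0 B T Psi) (m : ℕ) :
    ∀ j ∈ D.bdryInf, extendZero T m j = 0 := by
  intro j hj
  rw [extendZero]
  split_ifs with h
  · rfl
  · exact (hsol.bdry m (by omega) j hj).2.1

/-- The last half step of level `m` and the first of level `m + 1` are both trivial there. For `m =
0` the zero value comes from the initial function, which must vanish already on the layer `J 0 - 1`,
since the boundary stencil reaches it. -/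
theorem SolvesInf.breve_eq (hD : D.Admissible) (hsol : D.SolvesInf F Psi0 B T Psi)
    (hPsi0 : ∀ j ∈ D.intInf \ D.intFin, Psi0 j = 0)
    (hPsi0' : ∀ j ∈ D.meshInf, j 0 = (D.J 0 : ℤ) - 1 → Psi0 j = 0) (m : ℕ)
    {j : Fin (d + 1) → ℤ} (hj : j ∈ D.meshInf) (hj0 : (D.J 0 : ℤ) - 1 ≤ j 0) :
    B (m + 1) j = extendZero T m j := by
  by_cases h : j ∈ D.intInf
  · rw [hD.eq_of_halfStep h (by omega) (hsol.first (m + 1) (by omega) j h), extendZero,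
      Nat.add_sub_cancel]
    split_ifs with hm
    · subst hm
      rw [hsol.init j hj]
      rcases eq_or_lt_of_le hj0 with h0 | h0
      · exact hPsi0' j hj h0.symm
      · exact hPsi0 j ⟨h, fun hf => by have := hf.2; omega⟩
    · exact hD.eq_of_halfStep h (by omega) (hsol.last m (by omega) j h)
  · rw [(hsol.bdry (m + 1) (by omega) j ⟨hj, h⟩).1, hsol.extendZero_bdry m j ⟨hj, h⟩]

open Filter Topology in
theorem SolvesInf.tendsto_coef (hD : D.Admissible) (hsol : D.SolvesInf F Psi0 B T Psi)
    (hHh : ∀ m, D.MemHh (Psi m)) (m : ℕ) {q : Fin d → ℤ} (hq : q ∈ D.box) :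
    Tendsto (fun x : ℕ => D.coef (extendZero T m) q ((D.J 0 : ℤ) - 1 + x)) atTop (𝓝 0) := by
  have hJ := hD.three_le
  refine tendsto_sineFAll (fun i hi => ?_) q hq
  rcases Nat.eq_zero_or_pos m with rfl | hm
  · simp [extendZero]
  · have h := (hHh m).tendsto hi (x := fun x : ℕ => (D.J 0 : ℤ) - 1 + x)
      (fun n => by omega) (fun a b h => by simpa using h)
    refine h.congr fun n => ?_
    have hmem := mem_intInf_cons (D := D) (x := (D.J 0 : ℤ) - 1 + n) (by omega) hi
    rw [hD.eq_of_halfStep hmem (by rw [Fin.cons_zero]; omega) (hsol.last m hm _ hmem), extendZero,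
      if_neg (by omega)]

/-- The Fourier coefficients satisfy one-dimensional equations near and beyond the artificial
boundary. -/
theorem SolvesInf.coef_equation (hD : D.Admissible) (hsol : D.SolvesInf F Psi0 B T Psi)
    (hF : ∀ m, 1 ≤ m → ∀ j ∈ D.intInf \ D.intFin, F m j = 0)
    (hPsi0 : ∀ j ∈ D.intInf \ D.intFin, Psi0 j = 0)
    (hPsi0' : ∀ j ∈ D.meshInf, j 0 = (D.J 0 : ℤ) - 1 → Psi0 j = 0) (m : ℕ)
    {q : Fin d → ℤ} (hq : q ∈ D.box) {y : ℤ} (hy : (D.J 0 : ℤ) ≤ y) (f f' : ℤ → ℂ)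
    (hf : f = D.coef (extendZero T (m + 1)) q) (hf' : f' = D.coef (extendZero T m) q) :
    Complex.I * D.hbar * (D.tau : ℂ)⁻¹ *
      (1 / 12 * (f (y - 1) - f' (y - 1)) + 5 / 6 * (f y - f' y) +
        1 / 12 * (f (y + 1) - f' (y + 1))) =
      -(D.ch : ℂ) * (1 / 2) * (((D.step 0 : ℂ)⁻¹) ^ 2 * ((f (y - 1) + f' (y - 1))
        - 2 * (f y + f' y) + (f (y + 1) + f' (y + 1)))) +
      (D.Vq q : ℂ) * (1 / 2) * (1 / 12 * (f (y - 1) + f' (y - 1)) + 5 / 6 * (f y + f' y)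
        + 1 / 12 * (f (y + 1) + f' (y + 1))) := by
  have hJ := hD.three_le
  let W := D.series (extendZero T (m + 1))
  let W' := D.series (extendZero T m)
  have hmain : ∀ i ∈ D.box, Complex.I * D.hbar * ((D.tau : ℂ)⁻¹ *
        (sBar W (Fin.cons y i) - sBar W' (Fin.cons y i))) =
      -(D.ch : ℂ) * (1 / 2 * (D.lapN W (Fin.cons y i) + D.lapN W' (Fin.cons y i))) +
      D.Vinf * (1 / 2 * (sBar W (Fin.cons y i) + sBar W' (Fin.cons y i))) := by
    intro i hi
    have hj := mem_intInf_cons (D := D) (x := y) (by omega) hi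
    have h := hsol.main (m + 1) (by omega) _ hj
    rw [MainStep, hF (m + 1) (by omega) _ ⟨hj, fun hcon => by
      have := hcon.2; rw [Fin.cons_zero] at this; omega⟩, add_zero] at h
    have near : ∀ i' : Fin (d + 1) → ℤ, (∀ k, |i' k - (Fin.cons y i : Fin (d + 1) → ℤ) k| ≤ 1) →
        T (m + 1) i' = W i' ∧ B (m + 1) i' = W' i' ∧ D.Vt (D.node i' 0) = D.Vinf := by
      intro i' hi'
      have hmesh := mem_meshInf_of_near hj hi'
      have h0 := abs_le.1 (hi' 0)
      rw [Fin.cons_zero] at h0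
      refine ⟨?_, ?_, hD.Vt_const _ (hD.node_ge (by omega))⟩
      · exact hD.series_eq (hsol.extendZero_bdry (m + 1)) hmesh (by omega)
      · rw [hsol.breve_eq hD hPsi0 hPsi0' m hmesh (by omega)]
        exact hD.series_eq (hsol.extendZero_bdry m) hmesh (by omega)
    have hloc : IsLocal (fun _ => True) (sBar : Module.End ℂ (MeshFn d)) := IsLocal.sNprod _
    rw [hloc.congr (W := (D.tau : ℂ)⁻¹ • (T (m + 1) - B (m + 1))) (W' := (D.tau : ℂ)⁻¹ • (W - W')) fun i' hi' => by
        simp [(near i' hi').1, (near i' hi').2.1],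
      hloc.congr (W := D.mulVt _) (W' := (D.Vinf : ℂ) • ((1 / 2 : ℂ) • (W + W'))) fun i' hi' => by
        simp [mulVt, (near i' hi').1, (near i' hi').2.1, (near i' hi').2.2, mul_add],
      IsLocal.lapN.congr (W' := (1 / 2 : ℂ) • (W + W')) fun i' hi' => by
        simp [(near i' hi').1, (near i' hi').2.1]] at h
    simpa only [map_smul, map_sub, map_add, Pi.smul_apply, Pi.sub_apply, Pi.add_apply,
      smul_eq_mul] using h
  have hS := map_series (D := D) (A := sBar) (ev := fun f q x => D.sigProd q *
    (1 / 12 * f (x - 1) + 5 / 6 * f x + 1 / 12 * f (x + 1))) hD.sBar_tens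
  have hL := map_series (D := D) (A := D.lapN) (ev := fun f q x => D.sigProd q *
    ((D.step 0 : ℂ)⁻¹ ^ 2 * (f (x - 1) - 2 * f x + f (x + 1)) - D.lamSum q *
        (1 / 12 * f (x - 1) + 5 / 6 * f x + 1 / 12 * f (x + 1)))) hD.lapN_tens
  -- The residual of the one-dimensional equation, times the common eigenvalue of the transverse
  -- averages. Its sine series is the residual of the main step on the layer `y`, hence zero;
  -- `sigProd` is then cancelled.
  let res : TransFn d := fun q => D.sigProd q *
    (Complex.I * D.hbar * (D.tau : ℂ)⁻¹ *
      (1 / 12 * (D.coef (extendZero T (m + 1)) q (y - 1) - D.coef (extendZero T m) q (y - 1)) +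
        5 / 6 * (D.coef (extendZero T (m + 1)) q y - D.coef (extendZero T m) q y) +
        1 / 12 * (D.coef (extendZero T (m + 1)) q (y + 1) - D.coef (extendZero T m) q (y + 1))) -
      (-(D.ch : ℂ) * (1 / 2) * (((D.step 0 : ℂ)⁻¹) ^ 2 *
        ((D.coef (extendZero T (m + 1)) q (y - 1) + D.coef (extendZero T m) q (y - 1))
        - 2 * (D.coef (extendZero T (m + 1)) q y + D.coef (extendZero T m) q y) +
        (D.coef (extendZero T (m + 1)) q (y + 1) + D.coef (extendZero T m) q (y + 1)))) +
      (D.Vq q : ℂ) * (1 / 2) *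
        (1 / 12 * (D.coef (extendZero T (m + 1)) q (y - 1) + D.coef (extendZero T m) q (y - 1)) +
        5 / 6 * (D.coef (extendZero T (m + 1)) q y + D.coef (extendZero T m) q y)
        + 1 / 12 * (D.coef (extendZero T (m + 1)) q (y + 1) + D.coef (extendZero T m) q (y + 1)))))
  have hres : ∀ i ∈ D.box, D.sineFinvAll res i = 0 := by
    intro i hi
    have h := sub_eq_zero.2 (hmain i hi)
    simp only [W, W', hS, hL, Fin.cons_zero, Fin.tail_cons, ← Finset.sum_sub_distrib,
      ← Finset.sum_add_distrib, Finset.mul_sum] at h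
    rw [sineFinvAll_apply, ← h]
    refine Finset.sum_congr rfl fun q _ => ?_
    simp only [res, Vq_eq]
    ring
  have h := eq_zero_of_sineFinvAll_eq_zero hres hq
  rcases mul_eq_zero.1 h with h | h
  · exact absurd h (sigProd_ne_zero q)
  · rw [hf, hf']
    exact sub_eq_zero.1 h

theorem SolvesInf.transparent (hD : D.Admissible) (hsol : D.SolvesInf F Psi0 B T Psi)
    (hF : ∀ m, 1 ≤ m → ∀ j ∈ D.intInf \ D.intFin, F m j = 0)
    (hPsi0 : ∀ j ∈ D.intInf \ D.intFin, Psi0 j = 0)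
    (hPsi0' : ∀ j ∈ D.meshInf, j 0 = (D.J 0 : ℤ) - 1 → Psi0 j = 0)
    (hHh : ∀ m, D.MemHh (Psi m)) (m : ℕ) {j : Fin (d + 1) → ℤ} (hj : j ∈ D.artBdry) :
    D.D1h (T (m + 1)) (B (m + 1)) j =
      (D.ch : ℂ) * D.Sref (m + 1) (D.traceSeq T) (Fin.tail j) := by
  have hJ := hD.three_le
  obtain ⟨hjI, hj0⟩ := hj
  let W := D.series (extendZero T (m + 1))
  let W' := D.series (extendZero T m)
  have near : ∀ i' : Fin (d + 1) → ℤ, (∀ k, |i' k - j k| ≤ 1) →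
      T (m + 1) i' = W i' ∧ B (m + 1) i' = W' i' := by
    intro i' hi'
    have hmesh := mem_meshInf_of_near hjI hi'
    have h0 := abs_le.1 (hi' 0)
    constructor
    · exact hD.series_eq (hsol.extendZero_bdry (m + 1)) hmesh (by omega)
    · rw [hsol.breve_eq hD hPsi0 hPsi0' m hmesh (by omega)]
      exact hD.series_eq (hsol.extendZero_bdry m) hmesh (by omega)
  have nearT := fun i' hi' => (near i' hi').1
  have nearB := fun i' hi' => (near i' hi').2
  -- Each composition is kept as one operator because locality is known for the products.
  have expand : ∀ T B : MeshFn d, D.D1h T B j =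
      (D.ch : ℂ) * (1 / 2 * ((sBarHat 0 * D.bwd 0 : Module.End ℂ (MeshFn d)) T j +
        (sBarHat 0 * D.bwd 0 : Module.End ℂ (MeshFn d)) B j)) -
      (D.step 0 : ℂ) * (Complex.I * D.hbar * ((D.tau : ℂ)⁻¹ *
        ((sN1minus * sBarHat 0 : Module.End ℂ (MeshFn d)) T j -
          (sN1minus * sBarHat 0 : Module.End ℂ (MeshFn d)) B j)) +
        (D.ch * (1 / 2 * ((sN1minus * D.lapNTrans : Module.End ℂ (MeshFn d)) T j +
          (sN1minus * D.lapNTrans : Module.End ℂ (MeshFn d)) B j)) -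
        D.Vinf * (1 / 2 * ((sN1minus * sBarHat 0 : Module.End ℂ (MeshFn d)) T j +
          (sN1minus * sBarHat 0 : Module.End ℂ (MeshFn d)) B j)))) := by
    intro T B
    simp only [D1h, Module.End.mul_apply, map_smul, map_sub, map_add, Pi.smul_apply, Pi.sub_apply,
      Pi.add_apply, smul_eq_mul]
  rw [expand, IsLocal.sBarHat_bwd.congr nearT, IsLocal.sBarHat_bwd.congr nearB,
    IsLocal.sN1minus_sBarHat.congr nearT, IsLocal.sN1minus_sBarHat.congr nearB,
    IsLocal.sN1minus_lapNTrans.congr nearT, IsLocal.sN1minus_lapNTrans.congr nearB]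
  have h1 := map_series (D := D) (A := sBarHat 0 * D.bwd 0) (ev := fun f q x => D.sigProd q *
    ((D.step 0 : ℂ)⁻¹ * (f x - f (x - 1)))) hD.sBarHat_bwd_tens
  have h2 := map_series (D := D) (A := sN1minus * sBarHat 0) (ev := fun f q x => D.sigProd q *
    (5 / 12 * f x + 1 / 12 * f (x - 1))) hD.sN1minus_sBarHat_tens
  have h3 := map_series (D := D) (A := sN1minus * D.lapNTrans)
    (ev := fun f q x => -(D.sigProd q * D.lamSum q) *
    (5 / 12 * f x + 1 / 12 * f (x - 1))) hD.sN1minus_lapNTrans_tens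
  simp only [W, W', h1, h2, h3, hj0]
  rw [Sref, sineFinvAll_apply]
  simp only [← Finset.sum_sub_distrib, ← Finset.sum_add_distrib, Finset.mul_sum]
  refine Finset.sum_congr rfl fun q hq => ?_
  -- The half-line starts one layer inside: `x = 0` is the layer `J 0 - 1`, so `u 1` is the trace on
  -- the artificial boundary.
  have key := hD.transparent_one_dim (D.Vq q)
    (fun x m => D.coef (extendZero T m) q ((D.J 0 : ℤ) - 1 + x)) (fun x => ?_)
    (fun m => hsol.tendsto_coef hD hHh m hq) (fun x m => ?_) m
  · have hconv : conv (D.ker (D.Vq q)) (fun p => D.sineFAll (D.traceSeq T p) q) (m + 1) =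
        conv (D.ker (D.Vq q)) (fun m => D.coef (extendZero T m) q ((D.J 0 : ℤ) - 1 + (1 : ℕ)))
          (m + 1) := by
      congr 1
      funext p
      rw [coef, Nat.cast_one, sub_add_cancel, traceSeq, extendZero]
      split_ifs <;> rfl
    rw [hconv, ← sigProd]
    simp only [Nat.cast_one, Nat.cast_zero, sub_add_cancel, add_zero] at key ⊢
    rw [Vq_eq] at key
    linear_combination (D.sigProd q * D.sines q (Fin.tail j)) * key
  · have h := (sineFAll_zero (D := D) (d := d))
    simp only [coef, extendZero, if_true]
    exact congrFun h q
  -- The equation is centred at position `x + 1` of the half-line, that is, at the layer `J 0 + x`.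
  · have h := hsol.coef_equation hD hF hPsi0 hPsi0' m hq (y := (D.J 0 : ℤ) + x) (by omega) _ _
      rfl rfl
    have e1 : (D.J 0 : ℤ) + x - 1 = (D.J 0 : ℤ) - 1 + x := by ring
    have e2 : (D.J 0 : ℤ) + x = (D.J 0 : ℤ) - 1 + (x + 1 : ℕ) := by push_cast; ring
    have e3 : (D.J 0 : ℤ) + x + 1 = (D.J 0 : ℤ) - 1 + (x + 2 : ℕ) := by push_cast; ring
    rw [e1, e3, e2] at h
    exact h

end Solution

end Data

end SplitTBC

end

theorem mainTheorem2 {d : ℕ} (hd : 1 ≤ d) (D : SplitTBC.Data d) (hD : D.Admissible)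
    (F : ℕ → SplitTBC.MeshFn d) (Psi0 : SplitTBC.MeshFn d)
    (hF : ∀ m, 1 ≤ m → ∀ j ∈ D.intInf \ D.intFin, F m j = 0)
    (hPsi0 : ∀ j ∈ D.intInf \ D.intFin, Psi0 j = 0)
    (hPsi0' : ∀ j ∈ D.meshInf, j 0 = (D.J 0 : ℤ) - 1 → Psi0 j = 0)
    (B T Psi : ℕ → SplitTBC.MeshFn d)
    (hsol : D.SolvesInf F Psi0 B T Psi)
    (hHh : ∀ m, D.MemHh (Psi m)) :
    D.SolvesFin F Psi0 B T Psi ∧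
      ∀ v : ℝ, D.kerAlpha v ≠ 0 ∧
        SplitTBC.Data.argPos (D.kerAlpha v) ∈ Set.Ioo 0 (2 * Real.pi) ∧
        D.kerMu v ∈ Set.Ioo (-1 : ℝ) 1 := by
  have hint : D.intFin ∪ D.artBdry ⊆ D.intInf :=
    Set.union_subset (fun _ h => h.1) fun _ h => h.1
  refine ⟨⟨fun m hm j hj => hsol.first m hm j (hint hj), fun m hm j hj => hsol.main m hm j hj.1,
    fun m hm j hj => hsol.last m hm j (hint hj),
    fun m hm j hj => hsol.bdry m hm j (SplitTBC.Data.bdryFin_subset_bdryInf hj),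
    fun m hm j hj => ?_, fun j hj => hsol.init j hj.1⟩,
    fun v => ⟨hD.kerAlpha_ne_zero v, hD.argPos_kerAlpha_mem v, hD.kerMu_mem v⟩⟩
  obtain ⟨m, rfl⟩ := Nat.exists_eq_add_of_le' hm
  exact hsol.transparent hD hF hPsi0 hPsi0' hHh m hj
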